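/- **Setting.** Let $L\ge 3$, let $w_0=d_{in},w_1,\dots,w_{L-1},w_L=d_{out}$ be widths, and for $\theta=(W_1,\dots,W_L)$ with $W_l\in\mathbb R^{w_l\times w_{l-1}}$ put $A_\theta=W_L\cdots W_1$. Let $A^*\in\mathbb R^{d_{out}\times d_{in}}$, let $I$ be a non-empty set of observed entries $(i,j)$, and let $C_1>0$ satisfy $(A^*_{ij})^2\le C_1$ for all $(i,j)\in I$. For a ridge $\lambda>0$ and a learning rate $\eta>0$, SGD with replacement is $$\theta_{t+1}=(1-\eta\lambda)\theta_t-\tfrac{\eta}{2}\nabla_\theta\big(A^*_{i_tj_t}-A_{\theta_t,i_tj_t}\big)^2,$$ where $(i_0,j_0),(i_1,j_1),\dots$ are independent and uniformly distributed on $I$. Let $n=\max_{0\le l\le L}w_l$. For $\alpha>0$ let $f_\alpha(x)=\frac1{\alpha^2}x(2\alpha-x)$ for $x\le\alpha$ and $f_\alpha(x)=1$ for $x>\alpha$. For an integer $r\ge0$ and real $C$ and $\varepsilon_1,\varepsilon_2>0$, let $B_r$ be the set of all $\theta$ such that - $\|W_l\|_F^2\le C$ for $1\le l\le L$, - $\|W_lW_l^\top-W_{l+1}^\top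 W_{l+1}\|_2\le\varepsilon_1$ (spectral norm) for $1\le l\le L-1$, - $\sum_i f_\alpha\big(s_i(W_l^\top W_l)\big)\le r+\varepsilon_2$ for $1\le l\le L$, where $s_i$ denotes the singular values. **(1) $B_r$ is closed.** Suppose $C\ge\frac{C_1}{2\lambda}$, $\alpha\le\Big(\frac{\lambda^2}{2(C_1+C^L)}\Big)^{\frac1{L-2}}$, $\varepsilon_2<\frac12$, $\sqrt{\varepsilon_1}\le\frac{\lambda\alpha\varepsilon_2}{32nL(r+1)C^{\frac{L-1}2}\sqrt{2(C_1+C^L)}}$, and $$\eta\le\min\Big\{\tfrac{C_1}{4(2(C_1+C^L)C^{L-1}+\lambda^2C)},\ \tfrac{2\lambda\varepsilon_1}{4(C_1+C^L)C^{L-1}+\lambda^2\varepsilon_1},\ \tfrac{\lambda\alpha\varepsilon_2}{32n(r+1)(2(C_1+C^L)C^{L-1}+\lambda^2C)},\ \tfrac{2(r+1)}{\lambda}\Big\}.$$ Then $\theta_t\in B_r$ implies $\theta_{t+1}\in B_r$, whichever entry of $I$ is sampled. **(2) $B_r$ is reached.** Suppose $C\ge\frac{C_1}{\lambda}$, $\varepsilon_1\le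 C$, $4(n-r)(L-1)\,\varepsilon_1\le\alpha\varepsilon_2$ and $r\le\min\{d_{in},d_{out}\}$. Let $\theta_0$ be an arbitrary starting point, $C_0=\max_l\|W_l(0)\|_F^2$, and suppose $$\eta\le\min\Big\{\tfrac{C_1}{4(2(C_1+C_0^L)C_0^{L-1}+\lambda^2C_0)},\ \tfrac{\lambda\varepsilon_1}{4(C_1+C^L)C^{L-1}+2\lambda^2C}\Big\}$$ (the first bound being void if $C_0=0$). Then for all integers $T_0,T_1\ge0$ with $T_0\ge\frac{\log(2C_0/\varepsilon_1)}{\eta\lambda}$ and $T_1\ge\frac{\log(4(n-r)C/(\alpha\varepsilon_2))}{2\eta\lambda}$ (a bound being void where its logarithm is $\log 0$), $T=T_0+T_1$ satisfies $$\mathbb P(\theta_T\in B_r)\ \ge\ \Big(\frac r{\min\{d_{in},d_{out}\}}\Big)^{T_1}.$$ If moreover $r\ge1$, then $\mathbb P(\exists T:\ \theta_T\in B_r)=1$. -/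

import Mathlib

open MeasureTheory ProbabilityTheory

namespace DeepLinear

noncomputable section

/-- Parameters `θ = (W₁, …, W_L)` of a deep linear network of depth `L` and widths
`w 0, …, w L`; the matrix `W_{l+1}` of shape `w (l+1) × w l` is stored at index `l : Fin L`. -/
abbrev Params (L : ℕ) (w : ℕ → ℕ) : Type :=
  (l : Fin L) → Matrix (Fin (w (l + 1))) (Fin (w l)) ℝ

/-- The partial product `W_k ⋯ W_1` of the first `k` weight matrices. -/
def partialProd {L : ℕ} {w : ℕ → ℕ} (θ : Params L w) :
    (k : ℕ) → k ≤ L → Matrix (Fin (w k)) (Fin (w 0)) ℝ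
  | 0, _ => 1
  | k + 1, h => θ ⟨k, h⟩ * partialProd θ k (Nat.le_of_succ_le h)

/-- The matrix `A_θ = W_L ⋯ W_1` represented by the network. -/
def netMatrix {L : ℕ} {w : ℕ → ℕ} (θ : Params L w) : Matrix (Fin (w L)) (Fin (w 0)) ℝ :=
  partialProd θ L le_rfl

/-- The squared error `(A*_{ij} - A_{θ,ij})²` on the entry `p = (i, j)`. -/
def entryLoss {L : ℕ} {w : ℕ → ℕ} (Astar : Matrix (Fin (w L)) (Fin (w 0)) ℝ)
    (p : Fin (w L) × Fin (w 0)) (θ : Params L w) : ℝ :=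
  (Astar p.1 p.2 - netMatrix θ p.1 p.2) ^ 2

/-- The partial derivative of `g` at `θ` with respect to the entry `(a, b)` of the `l`-th weight
matrix, that is, the corresponding component of the gradient `∇_θ g`. -/
def gradEntry {L : ℕ} {w : ℕ → ℕ} (g : Params L w → ℝ) (θ : Params L w) (l : Fin L)
    (a : Fin (w (l + 1))) (b : Fin (w l)) : ℝ :=
  deriv (fun x : ℝ => g (Function.update θ l (θ l + Matrix.single a b x))) 0

/-- One step of SGD with learning rate `η` and ridge `lam` on the observed entry `p`:
`θ ↦ (1 - η λ) θ - (η / 2) ∇_θ (A*_p - A_{θ,p})²`. -/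
def sgdStep {L : ℕ} {w : ℕ → ℕ} (Astar : Matrix (Fin (w L)) (Fin (w 0)) ℝ) (lam η : ℝ)
    (p : Fin (w L) × Fin (w 0)) (θ : Params L w) : Params L w :=
  fun l => Matrix.of fun a b =>
    (1 - η * lam) * θ l a b - η / 2 * gradEntry (entryLoss Astar p) θ l a b

/-- The SGD iterates started at `θ₀` when entry `idx t` is sampled at step `t`. -/
def sgd {L : ℕ} {w : ℕ → ℕ} (Astar : Matrix (Fin (w L)) (Fin (w 0)) ℝ) (lam η : ℝ)
    (idx : ℕ → Fin (w L) × Fin (w 0)) (θ₀ : Params L w) : ℕ → Params L w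
  | 0 => θ₀
  | t + 1 => sgdStep Astar lam η (idx t) (sgd Astar lam η idx θ₀ t)

/-- The squared Frobenius norm `‖W‖_F²`. -/
def frobSq {m n : ℕ} (W : Matrix (Fin m) (Fin n) ℝ) : ℝ :=
  ∑ a, ∑ b, W a b ^ 2

/-- The spectral norm `‖M‖₂` of a square matrix. -/
def specNorm {m : ℕ} (M : Matrix (Fin m) (Fin m) ℝ) : ℝ :=
  ‖Matrix.toEuclideanCLM (n := Fin m) (𝕜 := ℝ) M‖

/-- The function `f_α`, a smoothed version of the indicator function of `x > 0`. -/
def fAlpha (α x : ℝ) : ℝ :=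
  if x ≤ α then 1 / α ^ 2 * x * (2 * α - x) else 1

/-- `F_α(σ(M)) = ∑ᵢ f_α(sᵢ(M))`, the sum over the singular values of the square matrix `M`. -/
def approxRank {m : ℕ} (α : ℝ) (M : Matrix (Fin m) (Fin m) ℝ) : ℝ :=
  ∑ i : Fin m, fAlpha α ((Matrix.toEuclideanLin M).singularValues i)

/-- `B_{C, ε₁}`: the parameters that are `C`-bounded and `ε₁`-approximately balanced. -/
def boundedBalanced (L : ℕ) (w : ℕ → ℕ) (C ε₁ : ℝ) : Set (Params L w) :=
  {θ | (∀ l, frobSq (θ l) ≤ C) ∧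
    ∀ (l : ℕ) (h : l + 1 < L),
      specNorm (θ ⟨l, Nat.lt_of_succ_lt h⟩ * (θ ⟨l, Nat.lt_of_succ_lt h⟩).transpose
        - (θ ⟨l + 1, h⟩).transpose * θ ⟨l + 1, h⟩) ≤ ε₁}

/-- `B_r`: the parameters in `B_{C, ε₁}` that are moreover approximately of rank at most `r`. -/
def setB (L : ℕ) (w : ℕ → ℕ) (r : ℕ) (C α ε₁ ε₂ : ℝ) : Set (Params L w) :=
  boundedBalanced L w C ε₁ ∩
    {θ | ∀ l, approxRank α ((θ l).transpose * θ l) ≤ r + ε₂}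

/-- The largest of the widths `w 0, …, w L`. -/
def maxWidth (L : ℕ) (w : ℕ → ℕ) : ℕ :=
  (Finset.range (L + 1)).sup w

/-- The largest squared Frobenius norm `max_l ‖W_l‖_F²` of a weight matrix. -/
def maxFrobSq {L : ℕ} {w : ℕ → ℕ} (θ : Params L w) : ℝ :=
  ⨆ l, frobSq (θ l)

/-- `idx 0, idx 1, …` are independent and uniformly distributed on the finite set `I`
(sampling with replacement). -/
def IsUniformSampling {ι Ω : Type*} [MeasurableSpace ι] [MeasurableSpace Ω] (P : Measure Ω)
    (I : Finset ι) (idx : ℕ → Ω → ι) : Prop :=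
  (∀ t, Measurable (idx t)) ∧ iIndepFun idx P ∧
    ∀ t, P.map (idx t) = uniformOn (I : Set ι)

end

end DeepLinear

/-!
For an observed entry `p = (i, j)` put `f_l = W_l ⋯ W_1 e_j` and `b_l = (W_L ⋯ W_{l+1})ᵀ e_i`. The
gradient of the loss at `p` with respect to each weight matrix has rank one, and a step of SGD is
`W_l ↦ (1 - ηλ) W_l + η ρ b_l f_{l-1}ᵀ` with the residual `ρ = A*_p - A_{θ,p}`
(`IsPath.sgdStep_eq`, where the weight matrix `W_{l+1}` has index `l`). Three facts follow. The first order effect of the gradient on `‖W_l‖_F²` is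
`2ηρ A_{θ,p} ≤ η C₁ / 2`, independently of `l`, so weight decay keeps the norms bounded
(`frobSq_sgdStep_le`). The first order effects on `W_l W_lᵀ` and on `W_{l+1}ᵀ W_{l+1}` are equal, so
the balance defect contracts up to an error of second order (`IsBalanced.sgdStep`). And only row `i`
of the last and column `j` of the first weight matrix feel the gradient.

*Closedness.* As `f_α` is concave, Peierls' inequality `approxRank_le_sum` bounds the approximate
rank after a step by a sum over the eigenvectors `q` of `W_lᵀ W_l` before the step, and tangents
bound each term: only `f_α'(s) (‖W_l' q‖² - s)` matters, where `s` is the eigenvalue of `q`. In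
exactly balanced networks all factors of `A_θ` act on `q` by the same singular value `√s`, whence the
gradient contributes at most `|ρ| s^{L/2}`; approximate balance perturbs this by a multiple of `√ε₁`
(`IsPath.abs_inner_mul_le`). For `s ≤ α` weight decay beats `|ρ| s^{L/2}`, with a margin comparable
to the distance of `f_α(s)` from the integers (`fAlphaDeriv_drift`). If the approximate rank is close
to `r + ε₂`, these distances add up to at least a multiple of `ε₂` (`le_sum_min`), which beats all
error terms; otherwise the error terms are too small to reach `r + ε₂` in one step.

*Reaching `B_r`.* After the burn-in time `T₀` the iterates are bounded and balanced for ever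
(`SmallStep.burn_in`). If from then on only entries in `r` chosen rows are sampled for `T₁` steps,
all other rows of the last weight matrix decay, which is then close to a matrix of rank `r`; this
passes to its transpose (`HasTail.transpose`), hence by balance to the neighbouring layer, and so on
through the network (`HasTail.all_layers`). The same holds for columns and the first weight matrix.
The `r` most frequent rows or columns carry a share of at least `r / min (w 0) (w L)` of the
observations, so that such a window of `T₁` steps has the stated probability; disjoint windows are
independent, and the second Borel–Cantelli lemma gives the almost sure statement.
-/

namespace DeepLinear

open scoped RealInnerProductSpace

/-! ### Matrices as linear maps, singular values of Gram matrices, and the trace of `f_α` -/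

/-- The linear map between Euclidean spaces given by a real matrix. -/
noncomputable abbrev op {m n : ℕ} (W : Matrix (Fin m) (Fin n) ℝ) :
    EuclideanSpace ℝ (Fin n) →ₗ[ℝ] EuclideanSpace ℝ (Fin m) :=
  Matrix.toEuclideanLin W

lemma inner_op {m n : ℕ} (W : Matrix (Fin m) (Fin n) ℝ) (x : EuclideanSpace ℝ (Fin n))
    (y : EuclideanSpace ℝ (Fin m)) : ⟪op W x, y⟫ = ⟪x, op W.transpose y⟫ := by
  have h := Matrix.toEuclideanLin_conjTranspose_eq_adjoint W
  rw [Matrix.conjTranspose_eq_transpose_of_trivial] at h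
  rw [op, op, h, LinearMap.adjoint_inner_right]

lemma op_mul_apply {m n k : ℕ} (A : Matrix (Fin m) (Fin n) ℝ) (B : Matrix (Fin n) (Fin k) ℝ)
    (x : EuclideanSpace ℝ (Fin k)) : op (A * B) x = op A (op B x) := by
  ext i
  simp [Matrix.toLpLin_apply, Matrix.mulVec_mulVec]

lemma inner_op_gram {m n : ℕ} (W : Matrix (Fin m) (Fin n) ℝ) (x y : EuclideanSpace ℝ (Fin n)) :
    ⟪x, op (W.transpose * W) y⟫ = ⟪op W x, op W y⟫ := by
  rw [op_mul_apply, inner_op]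

lemma frobSq_nonneg {m n : ℕ} (W : Matrix (Fin m) (Fin n) ℝ) : 0 ≤ frobSq W := by
  unfold frobSq; positivity

lemma frobSq_transpose {m n : ℕ} (W : Matrix (Fin m) (Fin n) ℝ) :
    frobSq W.transpose = frobSq W := by
  unfold frobSq; rw [Finset.sum_comm]; rfl

lemma op_basisFun {m n : ℕ} (W : Matrix (Fin m) (Fin n) ℝ) (b : Fin n) (a : Fin m) :
    op W (EuclideanSpace.basisFun (Fin n) ℝ b) a = W a b := by
  simp [Matrix.toLpLin_apply]

lemma norm_op_basisFun_sq {m n : ℕ} (W : Matrix (Fin m) (Fin n) ℝ) (b : Fin n) :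
    ‖op W (EuclideanSpace.basisFun (Fin n) ℝ b)‖ ^ 2 = ∑ a, W a b ^ 2 := by
  rw [EuclideanSpace.norm_sq_eq]
  simp

/-- Both sides are the Hilbert–Schmidt sum `∑ i k, ⟪W q_i, q'_k⟫ ^ 2`. -/
lemma sum_norm_op_sq_transpose {m n : ℕ} {ι κ : Type*} [Fintype ι] [Fintype κ]
    (W : Matrix (Fin m) (Fin n) ℝ)
    (q : OrthonormalBasis ι ℝ (EuclideanSpace ℝ (Fin n)))
    (q' : OrthonormalBasis κ ℝ (EuclideanSpace ℝ (Fin m))) :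
    ∑ i, ‖op W (q i)‖ ^ 2 = ∑ k, ‖op W.transpose (q' k)‖ ^ 2 := by
  simp_rw [← q'.sum_sq_inner_right, ← q.sum_sq_inner_right]
  rw [Finset.sum_comm]
  refine Finset.sum_congr rfl fun k _ => Finset.sum_congr rfl fun i _ => ?_
  rw [real_inner_comm, inner_op]

lemma frobSq_eq_sum {m n : ℕ} {ι : Type*} [Fintype ι] (W : Matrix (Fin m) (Fin n) ℝ)
    (q : OrthonormalBasis ι ℝ (EuclideanSpace ℝ (Fin n))) :
    frobSq W = ∑ i, ‖op W (q i)‖ ^ 2 := by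
  rw [sum_norm_op_sq_transpose W q (EuclideanSpace.basisFun (Fin m) ℝ)]
  simp_rw [norm_op_basisFun_sq]
  rfl

lemma norm_op_sq_le {m n : ℕ} (W : Matrix (Fin m) (Fin n) ℝ) (x : EuclideanSpace ℝ (Fin n)) :
    ‖op W x‖ ^ 2 ≤ frobSq W * ‖x‖ ^ 2 := by
  rw [← frobSq_transpose, frobSq_eq_sum _ (EuclideanSpace.basisFun (Fin m) ℝ),
    ← (EuclideanSpace.basisFun (Fin m) ℝ).sum_sq_inner_right (op W x), Finset.sum_mul]
  refine Finset.sum_le_sum fun i _ => ?_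
  rw [real_inner_comm, inner_op, ← mul_pow, mul_comm ‖op W.transpose _‖]
  exact sq_le_sq' (by linarith [abs_le.1 (abs_real_inner_le_norm x
      (op W.transpose (EuclideanSpace.basisFun (Fin m) ℝ i)))]) (real_inner_le_norm _ _)

lemma norm_op_le {m n : ℕ} {W : Matrix (Fin m) (Fin n) ℝ} {C : ℝ} (hW : frobSq W ≤ C)
    (x : EuclideanSpace ℝ (Fin n)) : ‖op W x‖ ≤ √C * ‖x‖ := by
  have hC : 0 ≤ C := (frobSq_nonneg W).trans hW
  refine le_of_sq_le_sq ?_ (by positivity)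
  rw [mul_pow, Real.sq_sqrt hC]
  exact (norm_op_sq_le W x).trans (by gcongr)

lemma norm_op_le_specNorm {m : ℕ} (D : Matrix (Fin m) (Fin m) ℝ)
    (x : EuclideanSpace ℝ (Fin m)) : ‖op D x‖ ≤ specNorm D * ‖x‖ :=
  (Matrix.toEuclideanCLM (n := Fin m) (𝕜 := ℝ) D).le_opNorm x

lemma abs_inner_op_le_specNorm {m : ℕ} (D : Matrix (Fin m) (Fin m) ℝ)
    (x : EuclideanSpace ℝ (Fin m)) : |⟪x, op D x⟫| ≤ specNorm D * ‖x‖ ^ 2 := by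
  refine (abs_real_inner_le_norm _ _).trans ?_
  nlinarith [norm_op_le_specNorm D x, norm_nonneg x]

/-- The spectral norm of a symmetric matrix is bounded by any bound on its quadratic form
(by polarization). -/
lemma specNorm_le {m : ℕ} {D : Matrix (Fin m) (Fin m) ℝ} (hD : D.transpose = D) {ε : ℝ}
    (hε : 0 ≤ ε) (h : ∀ x : EuclideanSpace ℝ (Fin m), |⟪x, op D x⟫| ≤ ε * ‖x‖ ^ 2) :
    specNorm D ≤ ε := by
  have hsymm : ∀ x y : EuclideanSpace ℝ (Fin m), ⟪x, op D y⟫ = ⟪y, op D x⟫ := fun x y => by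
    conv_lhs => rw [← hD, ← inner_op, real_inner_comm]
  have hbil : ∀ x y : EuclideanSpace ℝ (Fin m),
      ⟪y, op D x⟫ ≤ ε * (‖x‖ ^ 2 + ‖y‖ ^ 2) / 2 := fun x y => by
    have h1 := (abs_le.1 (h (x + y))).2
    have h2 := (abs_le.1 (h (x - y))).1
    have h3 := parallelogram_law_with_norm ℝ x y
    simp only [map_add, map_sub, inner_add_left, inner_add_right, inner_sub_left,
      inner_sub_right] at h1 h2
    rw [hsymm x y] at h1 h2
    nlinarith
  refine ContinuousLinearMap.opNorm_le_bound _ hε fun x => ?_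
  change ‖op D x‖ ≤ ε * ‖x‖
  rcases eq_or_ne (op D x) 0 with h0 | h0
  · rw [h0, norm_zero]; positivity
  -- test against the vector in the direction of `D x` that has the norm of `x`
  have hpos : 0 < ‖op D x‖ := norm_pos_iff.2 h0
  have h1 := hbil x ((‖x‖ / ‖op D x‖) • op D x)
  rw [real_inner_smul_left, real_inner_self_eq_norm_sq, norm_smul, Real.norm_of_nonneg
    (by positivity), div_mul_cancel₀ _ hpos.ne', pow_two ‖op D x‖, ← mul_assoc,
    div_mul_cancel₀ _ hpos.ne'] at h1
  rcases (norm_nonneg x).eq_or_lt with hx | hx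
  · rw [norm_eq_zero.1 hx.symm, map_zero] at h0; exact absurd rfl h0
  · nlinarith

/-- The quadratic form of the balance defect `W Wᵀ - Vᵀ V`. -/
lemma inner_op_defect {m n k : ℕ} (W : Matrix (Fin m) (Fin n) ℝ) (V : Matrix (Fin k) (Fin m) ℝ)
    (x : EuclideanSpace ℝ (Fin m)) :
    ⟪x, op (W * W.transpose - V.transpose * V) x⟫ = ‖op W.transpose x‖ ^ 2 - ‖op V x‖ ^ 2 := by
  have h1 := inner_op_gram W.transpose x x
  have h2 := inner_op_gram V x x
  rw [Matrix.transpose_transpose] at h1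
  rw [op, map_sub, LinearMap.sub_apply, inner_sub_right, h1, h2, real_inner_self_eq_norm_sq,
    real_inner_self_eq_norm_sq]

lemma defect_transpose {m n k : ℕ} (W : Matrix (Fin m) (Fin n) ℝ) (V : Matrix (Fin k) (Fin m) ℝ) :
    (W * W.transpose - V.transpose * V).transpose = W * W.transpose - V.transpose * V := by
  simp [Matrix.transpose_mul]

/-- The singular values of a Gram matrix are its eigenvalues. -/
lemma exists_gram_eigenbasis {m n : ℕ} (W : Matrix (Fin m) (Fin n) ℝ) :
    ∃ q : OrthonormalBasis (Fin n) ℝ (EuclideanSpace ℝ (Fin n)), ∀ i : Fin n,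
      op (W.transpose * W) (q i)
        = (Matrix.toEuclideanLin (W.transpose * W)).singularValues i • q i := by
  set T := Matrix.toEuclideanLin (W.transpose * W) with hT
  have hn : Module.finrank ℝ (EuclideanSpace ℝ (Fin n)) = n := by simp
  have hadj : T.adjoint = T := by
    rw [hT, ← Matrix.toEuclideanLin_conjTranspose_eq_adjoint]
    simp [Matrix.conjTranspose_eq_transpose_of_trivial, Matrix.transpose_mul]
  refine ⟨T.isSymmetric_adjoint_comp_self.eigenvectorBasis hn, fun i => ?_⟩
  set v := T.isSymmetric_adjoint_comp_self.eigenvectorBasis hn i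
  set σ := T.singularValues i
  have hσ : 0 ≤ σ := T.singularValues_nonneg i
  have hv : T (T v) = σ ^ 2 • v := by
    have := T.isSymmetric_adjoint_comp_self.apply_eigenvectorBasis hn i
    rw [LinearMap.comp_apply, ← T.sq_singularValues_fin hn i] at this
    exact (congrArg (fun S : _ →ₗ[ℝ] _ => S (T v)) hadj).symm.trans (mod_cast this)
  have hpos : ∀ y, 0 ≤ ⟪y, T y⟫ := fun y => by
    rw [hT]; exact (inner_op_gram W y y).symm ▸ real_inner_self_nonneg
  have hself : ∀ y z, ⟪T y, z⟫ = ⟪y, T z⟫ := fun y z => by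
    rw [← LinearMap.adjoint_inner_right, hadj]
  -- `y = T v - σ v` satisfies `T y = -σ y`, while `T` is positive
  have hy : T (T v - σ • v) = -(σ • (T v - σ • v)) := by
    rw [map_sub, map_smul, hv]; module
  have h1 := hpos (T v - σ • v)
  rw [hy, inner_neg_right, real_inner_smul_right, real_inner_self_eq_norm_sq] at h1
  change T v = σ • v
  rcases hσ.eq_or_lt with h0 | h0
  · rw [← h0, zero_smul]
    rw [← h0] at hv
    have : ⟪T v, T v⟫ = 0 := by rw [hself, hv]; simp
    exact inner_self_eq_zero.1 this
  · have h2 : ‖T v - σ • v‖ ^ 2 ≤ 0 := by nlinarith [sq_nonneg ‖T v - σ • v‖]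
    have h3 : ‖T v - σ • v‖ = 0 := by nlinarith [norm_nonneg (T v - σ • v)]
    exact sub_eq_zero.1 (norm_eq_zero.1 h3)

/-- The derivative of `f_α`. -/
noncomputable def fAlphaDeriv (α x : ℝ) : ℝ := if x ≤ α then 2 / α ^ 2 * (α - x) else 0

lemma fAlphaDeriv_nonneg {α : ℝ} (x : ℝ) : 0 ≤ fAlphaDeriv α x := by
  unfold fAlphaDeriv
  split_ifs with h
  · have := sub_nonneg.2 h; positivity
  · exact le_rfl

lemma fAlphaDeriv_le {α x : ℝ} (hα : 0 < α) (hx : 0 ≤ x) : fAlphaDeriv α x ≤ 2 / α := by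
  unfold fAlphaDeriv
  split_ifs with h
  · rw [div_mul_eq_mul_div, div_le_div_iff₀ (by positivity) hα]; nlinarith
  · positivity

lemma fAlpha_eq {α x : ℝ} (hα : 0 < α) (hx : x ≤ α) : fAlpha α x = 1 - (1 - x / α) ^ 2 := by
  rw [fAlpha, if_pos hx]; field_simp; ring

lemma fAlpha_le_one {α : ℝ} (hα : 0 < α) (x : ℝ) : fAlpha α x ≤ 1 := by
  by_cases hx : x ≤ α
  · rw [fAlpha_eq hα hx]; nlinarith [sq_nonneg (1 - x / α)]
  · rw [fAlpha, if_neg hx]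

lemma fAlpha_zero {α : ℝ} (hα : 0 < α) : fAlpha α 0 = 0 := by
  rw [fAlpha, if_pos hα.le]; ring

/-- `f_α` is concave: it lies below its tangents. -/
lemma fAlpha_le_tangent {α : ℝ} (hα : 0 < α) (x y : ℝ) :
    fAlpha α y ≤ fAlpha α x + fAlphaDeriv α x * (y - x) := by
  by_cases hx : x ≤ α
  · have hd : fAlphaDeriv α x * (y - x) = 2 * (1 - x / α) * (y / α - x / α) := by
      rw [fAlphaDeriv, if_pos hx]; field_simp
    have hx' : x / α ≤ 1 := (div_le_one hα).2 hx
    rw [hd, fAlpha_eq hα hx]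
    by_cases hy : y ≤ α
    · rw [fAlpha_eq hα hy]; nlinarith [sq_nonneg (x / α - y / α)]
    · have hy' : 1 < y / α := (one_lt_div hα).2 (not_le.1 hy)
      rw [fAlpha, if_neg hy]; nlinarith
  · have : fAlpha α x = 1 := if_neg hx
    have hd : fAlphaDeriv α x = 0 := if_neg hx
    rw [this, hd]; linarith [fAlpha_le_one hα y]

/-- Peierls' inequality: as `f_α` is concave, its trace is at most the sum of its values at the
diagonal entries in any orthonormal basis. -/
lemma approxRank_le_sum {m n : ℕ} {α : ℝ} (hα : 0 < α) (W : Matrix (Fin m) (Fin n) ℝ)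
    (e : OrthonormalBasis (Fin n) ℝ (EuclideanSpace ℝ (Fin n))) :
    approxRank α (W.transpose * W) ≤ ∑ j, fAlpha α (‖op W (e j)‖ ^ 2) := by
  obtain ⟨q, hq⟩ := exists_gram_eigenbasis W
  set s : Fin n → ℝ := fun i => (Matrix.toEuclideanLin (W.transpose * W)).singularValues i
  have hdiag : ∀ j, ‖op W (e j)‖ ^ 2 = ∑ i, ⟪q i, e j⟫ ^ 2 * s i := fun j => by
    rw [← real_inner_self_eq_norm_sq, ← inner_op_gram, ← q.sum_inner_mul_inner]
    refine Finset.sum_congr rfl fun i _ => ?_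
    have : ⟪q i, op (W.transpose * W) (e j)⟫ = s i * ⟪q i, e j⟫ := by
      rw [inner_op_gram, real_inner_comm, ← inner_op_gram, hq, real_inner_smul_right,
        real_inner_comm]
    rw [this, real_inner_comm]; ring
  have hjensen : ∀ j, ∑ i, ⟪q i, e j⟫ ^ 2 * fAlpha α (s i) ≤ fAlpha α (‖op W (e j)‖ ^ 2) := by
    intro j
    set y := ‖op W (e j)‖ ^ 2
    have h1 : ∑ i, ⟪q i, e j⟫ ^ 2 = 1 := by
      rw [q.sum_sq_inner_right, e.norm_eq_one, one_pow]
    calc ∑ i, ⟪q i, e j⟫ ^ 2 * fAlpha α (s i)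
        ≤ ∑ i, ⟪q i, e j⟫ ^ 2 * (fAlpha α y + fAlphaDeriv α y * (s i - y)) :=
          Finset.sum_le_sum fun i _ =>
            mul_le_mul_of_nonneg_left (fAlpha_le_tangent hα _ _) (sq_nonneg _)
      _ = (∑ i, ⟪q i, e j⟫ ^ 2) * (fAlpha α y - fAlphaDeriv α y * y)
          + fAlphaDeriv α y * ∑ i, ⟪q i, e j⟫ ^ 2 * s i := by
          rw [Finset.sum_mul, Finset.mul_sum, ← Finset.sum_add_distrib]
          exact Finset.sum_congr rfl fun i _ => by ring
      _ = fAlpha α y := by rw [h1, ← hdiag j]; ring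
  calc approxRank α (W.transpose * W)
      = ∑ i, (∑ j, ⟪e j, q i⟫ ^ 2) * fAlpha α (s i) := by
        refine Finset.sum_congr rfl fun i _ => ?_
        rw [e.sum_sq_inner_right, q.norm_eq_one, one_pow, one_mul]
    _ = ∑ j, ∑ i, ⟪q i, e j⟫ ^ 2 * fAlpha α (s i) := by
        simp_rw [Finset.sum_mul]
        rw [Finset.sum_comm]
        simp_rw [real_inner_comm]
    _ ≤ _ := Finset.sum_le_sum fun j _ => hjensen j

/-! ### Matrices that are close to rank `r` -/

/-- `W` is within squared Frobenius distance `τ` of a matrix of rank at most `r`, witnessed by an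
orthonormal system of `n - r` input directions on which `W` has squared Hilbert–Schmidt norm at
most `τ` (truncated subtraction: the system is empty for `n ≤ r`). -/
def HasTail {m n : ℕ} (r : ℕ) (τ : ℝ) (W : Matrix (Fin m) (Fin n) ℝ) : Prop :=
  ∃ v : Fin (n - r) → EuclideanSpace ℝ (Fin n), Orthonormal ℝ v ∧ ∑ i, ‖op W (v i)‖ ^ 2 ≤ τ

lemma HasTail.mono {m n r : ℕ} {τ τ' : ℝ} {W : Matrix (Fin m) (Fin n) ℝ} (h : HasTail r τ W)
    (hτ : τ ≤ τ') : HasTail r τ' W := by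
  obtain ⟨v, hv, hs⟩ := h; exact ⟨v, hv, hs.trans hτ⟩

/-- The directions for `Wᵀ` are chosen in the subspace of vectors that `Wᵀ` maps into the span of
the directions for `W`; it has codimension at most `r`, and there `Wᵀ` is controlled by Bessel's
inequality. -/
lemma HasTail.transpose {m n r : ℕ} {τ : ℝ} {W : Matrix (Fin m) (Fin n) ℝ} (h : HasTail r τ W) :
    HasTail r τ W.transpose := by
  obtain ⟨v, hv, hs⟩ := h
  set V := Submodule.span ℝ (Set.range v) with hV
  set K := V.comap (op W.transpose) with hK
  have hVdim : Module.finrank ℝ V = n - r := by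
    rw [hV, finrank_span_eq_card hv.linearIndependent, Fintype.card_fin]
  have hKdim : m - r ≤ Module.finrank ℝ K := by
    have h1 := ((V.mkQ).comp (op W.transpose)).finrank_range_add_finrank_ker
    rw [LinearMap.ker_comp, Submodule.ker_mkQ, finrank_euclideanSpace_fin] at h1
    have h2 := Submodule.finrank_le (LinearMap.range ((V.mkQ).comp (op W.transpose)))
    have h3 := V.finrank_quotient_add_finrank
    rw [hVdim, finrank_euclideanSpace_fin] at h3
    have h4 : Module.finrank ℝ K = Module.finrank ℝ (V.comap (op W.transpose)) := rfl
    omega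
  let b := stdOrthonormalBasis ℝ K
  let u : Fin (m - r) → EuclideanSpace ℝ (Fin m) := fun i => (b (Fin.castLE hKdim i) : K)
  have hu : Orthonormal ℝ u :=
    (b.orthonormal.comp_linearIsometry K.subtypeₗᵢ).comp _ (Fin.castLE_injective hKdim)
  refine ⟨u, hu, le_trans ?_ hs⟩
  have hpars : ∀ j, ‖op W.transpose (u j)‖ ^ 2 = ∑ i, ⟪u j, op W (v i)⟫ ^ 2 := fun j => by
    have hmem : op W.transpose (u j) ∈ V := (b (Fin.castLE hKdim j)).2
    obtain ⟨c, hc⟩ := (Submodule.mem_span_range_iff_exists_fun ℝ).1 hmem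
    have hci : ∀ i, c i = ⟪u j, op W (v i)⟫ := fun i => by
      rw [real_inner_comm, inner_op, ← hc]
      exact (hv.inner_right_fintype c i).symm
    rw [← real_inner_self_eq_norm_sq, ← hc, hv.inner_sum]
    simp_rw [← hci, pow_two]
    simp
  simp_rw [hpars]
  rw [Finset.sum_comm]
  refine Finset.sum_le_sum fun i _ => ?_
  simpa using hu.sum_inner_products_le (op W (v i)) (s := Finset.univ)

lemma fAlpha_le_mul {α x : ℝ} (hα : 0 < α) : fAlpha α x ≤ 2 / α * x := by
  have h := fAlpha_le_tangent hα 0 x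
  rw [fAlpha_zero hα, zero_add, sub_zero, fAlphaDeriv, if_pos hα.le] at h
  convert h using 2; field_simp; ring

lemma HasTail.approxRank_le {m n r : ℕ} {τ α : ℝ} (hα : 0 < α) {W : Matrix (Fin m) (Fin n) ℝ}
    (h : HasTail r τ W) : approxRank α (W.transpose * W) ≤ r + 2 / α * τ := by
  obtain ⟨v, hv, hs⟩ := h
  let s : Set (Fin n) := {i | i.1 < n - r}
  let v' : Fin n → EuclideanSpace ℝ (Fin n) := fun i => if h : i.1 < n - r then v ⟨i, h⟩ else 0
  have hv' : Orthonormal ℝ (s.domRestrict v') := by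
    have : s.domRestrict v' = v ∘ fun i : s => (⟨i.1.1, i.2⟩ : Fin (n - r)) := by
      funext i
      exact dif_pos i.2
    rw [this]
    exact hv.comp _ fun i j hij => Subtype.ext (Fin.ext (by simpa using hij))
  obtain ⟨e, he⟩ := hv'.exists_orthonormalBasis_extension_of_card_eq (by simp)
  refine (approxRank_le_sum hα W e).trans ?_
  have hle : n - r ≤ n := Nat.sub_le _ _
  rw [← Finset.sum_filter_add_sum_filter_not Finset.univ (fun i : Fin n => i.1 < n - r), add_comm]
  refine add_le_add ?_ ?_
  · refine (Finset.sum_le_card_nsmul _ _ 1 fun i _ => fAlpha_le_one hα _).trans ?_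
    rw [nsmul_eq_mul, mul_one, Nat.cast_le, Finset.filter_not,
      Finset.card_sdiff_of_subset (Finset.filter_subset _ _), Finset.card_univ, Fintype.card_fin, Fin.card_filter_val_lt]
    omega
  · refine le_trans ?_ (mul_le_mul_of_nonneg_left hs (by positivity))
    rw [Finset.mul_sum]
    refine (Finset.sum_le_sum fun i _ => fAlpha_le_mul hα).trans (le_of_eq ?_)
    symm
    refine Finset.sum_bij (fun i _ => Fin.castLE hle i) (by simp) ?_ ?_ ?_
    · intro i _ j _ h; exact Fin.castLE_injective hle h
    · intro i hi; exact ⟨⟨i, by simpa using hi⟩, Finset.mem_univ _, rfl⟩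
    · intro i _
      rw [he (Fin.castLE hle i) i.2]
      simp [v']

/-- Approximate balance carries a tail from one weight matrix to a neighbouring one. -/
lemma HasTail.of_quadratic_le {m n k r : ℕ} {τ ε : ℝ} {V : Matrix (Fin m) (Fin n) ℝ}
    {W : Matrix (Fin k) (Fin n) ℝ} (h : HasTail r τ V)
    (hVW : ∀ x, ‖op W x‖ ^ 2 ≤ ‖op V x‖ ^ 2 + ε * ‖x‖ ^ 2) :
    HasTail r (τ + (n - r : ℕ) * ε) W := by
  obtain ⟨v, hv, hs⟩ := h
  refine ⟨v, hv, (Finset.sum_le_sum fun i _ => hVW (v i)).trans ?_⟩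
  rw [Finset.sum_add_distrib]
  refine add_le_add hs (le_of_eq ?_)
  simp [hv.1]

/-! ### The gradient of the loss at one entry -/

/-- The weight matrices of `θ`, extended by `0` to all layers `k : ℕ`. -/
def weight {L : ℕ} {w : ℕ → ℕ} (θ : Params L w) (k : ℕ) :
    Matrix (Fin (w (k + 1))) (Fin (w k)) ℝ :=
  if h : k < L then θ ⟨k, h⟩ else 0

lemma weight_of_lt {L : ℕ} {w : ℕ → ℕ} (θ : Params L w) {k : ℕ} (h : k < L) :
    weight θ k = θ ⟨k, h⟩ := dif_pos h

lemma frobSq_weight_le {L : ℕ} {w : ℕ → ℕ} {θ : Params L w} {K : ℝ} (hK : 0 ≤ K)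
    (h : ∀ l, frobSq (θ l) ≤ K) (k : ℕ) : frobSq (weight θ k) ≤ K := by
  unfold weight
  split_ifs with hk
  · exact h _
  · simpa [frobSq] using hK

/-- `z` is propagated forward through the layers `m, …, N - 1`. -/
def IsForward {w : ℕ → ℕ} (A : ∀ k, Matrix (Fin (w (k + 1))) (Fin (w k)) ℝ) (m N : ℕ)
    (z : ∀ k, EuclideanSpace ℝ (Fin (w k))) : Prop :=
  ∀ k, m ≤ k → k < N → z (k + 1) = op (A k) (z k)

/-- `y` is propagated backward, by the transposes, through the layers `N - 1, …, m`. -/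
def IsBackward {w : ℕ → ℕ} (A : ∀ k, Matrix (Fin (w (k + 1))) (Fin (w k)) ℝ) (m N : ℕ)
    (y : ∀ k, EuclideanSpace ℝ (Fin (w k))) : Prop :=
  ∀ k, m ≤ k → k < N → y k = op (A k).transpose (y (k + 1))

section Propagation

variable {w : ℕ → ℕ} (A : ∀ k, Matrix (Fin (w (k + 1))) (Fin (w k)) ℝ)

lemma exists_isForward (m N : ℕ) (q : EuclideanSpace ℝ (Fin (w m))) :
    ∃ z, z m = q ∧ IsForward A m N z := by
  induction N with
  | zero => exact ⟨Function.update 0 m q, by simp, fun k _ h => absurd h (Nat.not_lt_zero k)⟩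
  | succ N ih =>
    obtain ⟨z, hz, hf⟩ := ih
    rcases le_or_gt m N with hmN | hmN
    · refine ⟨Function.update z (N + 1) (op (A N) (z N)), ?_, fun k hk hkN => ?_⟩
      · rw [Function.update_of_ne (by omega), hz]
      · rw [Function.update_of_ne (by omega : k ≠ N + 1)]
        rcases (Nat.lt_succ_iff.1 hkN).eq_or_lt with rfl | hlt
        · rw [Function.update_self]
        · rw [Function.update_of_ne (by omega), hf k hk hlt]
    · exact ⟨z, hz, fun k hk hkN => by omega⟩

lemma exists_isBackward (N : ℕ) (q : EuclideanSpace ℝ (Fin (w N))) :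
    ∃ y, y N = q ∧ IsBackward A 0 N y := by
  induction N with
  | zero => exact ⟨Function.update 0 0 q, by simp, fun k _ h => absurd h (Nat.not_lt_zero k)⟩
  | succ N ih =>
    obtain ⟨y, hy, hb⟩ := ih (op (A N).transpose q)
    refine ⟨Function.update y (N + 1) q, by simp, fun k hk hkN => ?_⟩
    rw [Function.update_of_ne (by omega : k ≠ N + 1)]
    rcases (Nat.lt_succ_iff.1 hkN).eq_or_lt with rfl | hlt
    · rw [Function.update_self, hy]
    · rw [Function.update_of_ne (by omega), hb k hk hlt]

variable {A}

lemma inner_backward_forward {m N : ℕ} {y z : ∀ k, EuclideanSpace ℝ (Fin (w k))}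
    (hy : IsBackward A m N y) (hz : IsForward A m N z) {k : ℕ} (hk : m ≤ k) (hkN : k ≤ N) :
    ⟪y k, z k⟫ = ⟪y N, z N⟫ := by
  induction N, hkN using Nat.le_induction with
  | base => rfl
  | succ N hN ih =>
    rw [ih (fun j h1 h2 => hy j h1 (by omega)) (fun j h1 h2 => hz j h1 (by omega)),
      hy N (by omega) (by omega), hz N (by omega) (by omega), real_inner_comm, ← inner_op,
      real_inner_comm]

lemma IsForward.norm_le {m N : ℕ} {z : ∀ k, EuclideanSpace ℝ (Fin (w k))}
    (hz : IsForward A m N z) {K : ℝ} (hK : ∀ k, frobSq (A k) ≤ K) {k : ℕ} (hk : m ≤ k)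
    (hkN : k ≤ N) : ‖z k‖ ≤ √K ^ (k - m) * ‖z m‖ := by
  induction k, hk using Nat.le_induction with
  | base => simp
  | succ k hk ih =>
    rw [hz k hk (by omega), Nat.succ_sub hk, pow_succ', mul_assoc]
    exact (norm_op_le (hK k) _).trans (by gcongr; exact ih (by omega))

lemma IsBackward.norm_le {m N : ℕ} {y : ∀ k, EuclideanSpace ℝ (Fin (w k))}
    (hy : IsBackward A m N y) {K : ℝ} (hK : ∀ k, frobSq (A k) ≤ K) {k : ℕ} (hk : m ≤ k)
    (hkN : k ≤ N) : ‖y k‖ ≤ √K ^ (N - k) * ‖y N‖ := by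
  induction N, hkN using Nat.le_induction with
  | base => simp
  | succ N hN ih =>
    refine (ih fun j h1 h2 => hy j h1 (by omega)).trans ?_
    rw [hy N (by omega) (by omega), Nat.succ_sub hN, pow_succ, mul_assoc]
    gcongr
    exact norm_op_le ((frobSq_transpose (A N)).trans_le (hK N)) _

end Propagation

/-- For the observed entry `p = (i, j)`: the forward images `f k = W_k ⋯ W_1 e_j` of the input and
the backward images `b k = (W_L ⋯ W_{k+1})ᵀ e_i` of the output basis vector. They carry the
gradient of the loss at `p`. -/
structure IsPath {L : ℕ} {w : ℕ → ℕ} (θ : Params L w) (p : Fin (w L) × Fin (w 0))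
    (f b : ∀ k, EuclideanSpace ℝ (Fin (w k))) : Prop where
  f_zero : f 0 = EuclideanSpace.basisFun _ ℝ p.2
  forward : IsForward (weight θ) 0 L f
  b_last : b L = EuclideanSpace.basisFun _ ℝ p.1
  backward : IsBackward (weight θ) 0 L b

lemma exists_isPath {L : ℕ} {w : ℕ → ℕ} (θ : Params L w) (p : Fin (w L) × Fin (w 0)) :
    ∃ f b, IsPath θ p f b := by
  obtain ⟨f, hf0, hf⟩ := exists_isForward (weight θ) 0 L (EuclideanSpace.basisFun _ ℝ p.2)
  obtain ⟨b, hb0, hb⟩ := exists_isBackward (weight θ) L (EuclideanSpace.basisFun _ ℝ p.1)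
  exact ⟨f, b, hf0, hf, hb0, hb⟩

lemma op_partialProd {L : ℕ} {w : ℕ → ℕ} (θ : Params L w)
    {f : ∀ k, EuclideanSpace ℝ (Fin (w k))} (hf : IsForward (weight θ) 0 L f) (k : ℕ)
    (hk : k ≤ L) : op (partialProd θ k hk) (f 0) = f k := by
  induction k with
  | zero => ext; simp [partialProd]
  | succ k ih =>
    rw [partialProd, op_mul_apply, ih, hf k (Nat.zero_le _) hk, weight_of_lt θ hk]

lemma netMatrix_eq_inner {L : ℕ} {w : ℕ → ℕ} {θ : Params L w} {p : Fin (w L) × Fin (w 0)}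
    {f : ∀ k, EuclideanSpace ℝ (Fin (w k))} (hf : IsForward (weight θ) 0 L f)
    (hf0 : f 0 = EuclideanSpace.basisFun _ ℝ p.2) :
    netMatrix θ p.1 p.2 = ⟪EuclideanSpace.basisFun _ ℝ p.1, f L⟫ := by
  rw [← op_partialProd θ hf L le_rfl, hf0, EuclideanSpace.basisFun_inner, op_basisFun]
  rfl

namespace IsPath

variable {L : ℕ} {w : ℕ → ℕ} {θ : Params L w} {p : Fin (w L) × Fin (w 0)}
  {f b : ∀ k, EuclideanSpace ℝ (Fin (w k))}

lemma inner_eq (h : IsPath θ p f b) {k : ℕ} (hk : k ≤ L) :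
    ⟪b k, f k⟫ = netMatrix θ p.1 p.2 := by
  rw [inner_backward_forward h.backward h.forward (Nat.zero_le k) hk,
    netMatrix_eq_inner h.forward h.f_zero, h.b_last]

lemma op_f (h : IsPath θ p f b) (l : Fin L) : op (θ l) (f l) = f (l + 1) := by
  rw [h.forward l (Nat.zero_le _) l.2, weight_of_lt θ l.2]

lemma op_transpose_b (h : IsPath θ p f b) (l : Fin L) :
    op (θ l).transpose (b (l + 1)) = b l := by
  rw [h.backward l (Nat.zero_le _) l.2, weight_of_lt θ l.2]

/-- The represented matrix is affine in each entry of each weight matrix. -/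
lemma netMatrix_update (h : IsPath θ p f b) (l : Fin L) (a : Fin (w (l + 1))) (c : Fin (w l))
    (x : ℝ) :
    netMatrix (Function.update θ l (θ l + Matrix.single a c x)) p.1 p.2
      = netMatrix θ p.1 p.2 + x * (b (l + 1) a * f l c) := by
  set θ' := Function.update θ l (θ l + Matrix.single a c x) with hθ'
  have hw : ∀ k : ℕ, k ≠ l → weight θ' k = weight θ k := fun k hk => by
    unfold weight
    split_ifs with hkL
    · rw [hθ', Function.update_of_ne (fun h => hk (congrArg Fin.val h))]
    · rfl
  have hwl : weight θ' l = θ l + Matrix.single a c x := by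
    rw [weight_of_lt _ l.2, hθ']; exact Function.update_self ..
  obtain ⟨g, hg0, hg⟩ := exists_isForward (weight θ') 0 L (EuclideanSpace.basisFun _ ℝ p.2)
  have hfg : ∀ k ≤ l.1, g k = f k := by
    intro k
    induction k with
    | zero => intro _; rw [hg0, h.f_zero]
    | succ k ih =>
      intro hk
      rw [hg k (Nat.zero_le _) (by omega), hw k (by omega), ih (by omega),
        h.forward k (Nat.zero_le _) (by omega)]
  have hb : IsBackward (weight θ') (l + 1) L b := fun k hk hkL => by
    rw [hw k (by omega)]; exact h.backward k (Nat.zero_le _) hkL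
  have hl : l.1 + 1 ≤ L := l.2
  rw [netMatrix_eq_inner hg hg0, ← h.b_last,
    ← inner_backward_forward hb (fun k _ hk => hg k (Nat.zero_le _) hk) le_rfl hl,
    hg l (Nat.zero_le _) l.2, hwl, hfg l le_rfl, op, map_add, LinearMap.add_apply, inner_add_right,
    ← op, ← op, h.op_f, h.inner_eq hl]
  congr 1
  have : op (Matrix.single a c x) (f l) = (x * f l c) • EuclideanSpace.basisFun _ ℝ a := by
    ext i
    simp [Matrix.toLpLin_apply, Matrix.single_mulVec, Function.update_apply]
  rw [this, real_inner_smul_right, real_inner_comm, EuclideanSpace.basisFun_inner]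
  ring

lemma gradEntry_eq (h : IsPath θ p f b) (Astar : Matrix (Fin (w L)) (Fin (w 0)) ℝ) (l : Fin L)
    (a : Fin (w (l + 1))) (c : Fin (w l)) :
    gradEntry (entryLoss Astar p) θ l a c
      = -2 * (Astar p.1 p.2 - netMatrix θ p.1 p.2) * (b (l + 1) a * f l c) := by
  unfold gradEntry entryLoss
  simp_rw [h.netMatrix_update l a c]
  set d := b (l + 1) a * f l c
  have h1 : HasDerivAt (fun x : ℝ => Astar p.1 p.2 - (netMatrix θ p.1 p.2 + x * d)) (-d) 0 := by
    have := (((hasDerivAt_id (0 : ℝ)).mul_const d).const_add (netMatrix θ p.1 p.2)).const_sub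
      (Astar p.1 p.2)
    simpa using this
  refine ((h1.pow 2).deriv).trans ?_
  push_cast
  ring

/-- The gradient step adds a rank one matrix to each shrunk weight matrix. -/
lemma sgdStep_eq (h : IsPath θ p f b) (Astar : Matrix (Fin (w L)) (Fin (w 0)) ℝ) (lam η : ℝ)
    (l : Fin L) :
    sgdStep Astar lam η p θ l = (1 - η * lam) • θ l
      + (η * (Astar p.1 p.2 - netMatrix θ p.1 p.2)) • Matrix.vecMulVec (b (l + 1)) (f l) := by
  ext a c
  simp only [sgdStep, Matrix.of_apply, h.gradEntry_eq, Matrix.add_apply, Matrix.smul_apply,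
    Matrix.vecMulVec_apply, smul_eq_mul]
  ring

end IsPath

section RankOne

variable {m n : ℕ} (W : Matrix (Fin m) (Fin n) ℝ) (u : EuclideanSpace ℝ (Fin m))
  (v : EuclideanSpace ℝ (Fin n)) (c d : ℝ)

lemma op_add_vecMulVec (x : EuclideanSpace ℝ (Fin n)) :
    op (c • W + d • Matrix.vecMulVec u v) x = c • op W x + (d * ⟪v, x⟫) • u := by
  ext i
  have : ⟪v, x⟫ = ∑ k, v k * x k := by
    simp [PiLp.inner_apply, mul_comm]
  simp [Matrix.toLpLin_apply, this,
    Matrix.vecMulVec_mulVec, dotProduct, mul_comm, mul_left_comm]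

lemma transpose_add_vecMulVec :
    (c • W + d • Matrix.vecMulVec u v).transpose
      = c • W.transpose + d • Matrix.vecMulVec v u := by
  simp [Matrix.transpose_vecMulVec]

lemma frobSq_add_vecMulVec :
    frobSq (c • W + d • Matrix.vecMulVec u v)
      = c ^ 2 * frobSq W + 2 * c * d * ⟪u, op W v⟫ + d ^ 2 * (‖u‖ ^ 2 * ‖v‖ ^ 2) := by
  have h1 : ⟪u, op W v⟫ = ∑ a, ∑ b, W a b * (u a * v b) := by
    simp [PiLp.inner_apply, Matrix.toLpLin_apply, Matrix.mulVec, dotProduct, Finset.mul_sum,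
      mul_left_comm, mul_comm]
  have h2 : ‖u‖ ^ 2 * ‖v‖ ^ 2 = ∑ a, ∑ b, (u a * v b) ^ 2 := by
    simp_rw [EuclideanSpace.norm_sq_eq, Finset.sum_mul_sum, Real.norm_eq_abs, sq_abs, mul_pow]
  rw [h1, h2, frobSq, frobSq, Finset.mul_sum, Finset.mul_sum, Finset.mul_sum,
    ← Finset.sum_add_distrib, ← Finset.sum_add_distrib]
  refine Finset.sum_congr rfl fun a _ => ?_
  rw [Finset.mul_sum, Finset.mul_sum, Finset.mul_sum,
    ← Finset.sum_add_distrib, ← Finset.sum_add_distrib]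
  refine Finset.sum_congr rfl fun b _ => ?_
  simp only [Matrix.add_apply, Matrix.smul_apply, Matrix.vecMulVec_apply, smul_eq_mul]
  ring

end RankOne

/-! ### Norms and balance defects after one step -/

/-- All balance defects `W_l W_lᵀ - W_{l+1}ᵀ W_{l+1}` have spectral norm at most `D`. -/
def IsBalanced {L : ℕ} {w : ℕ → ℕ} (θ : Params L w) (D : ℝ) : Prop :=
  ∀ (l : ℕ) (h : l + 1 < L),
    specNorm (θ ⟨l, Nat.lt_of_succ_lt h⟩ * (θ ⟨l, Nat.lt_of_succ_lt h⟩).transpose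
      - (θ ⟨l + 1, h⟩).transpose * θ ⟨l + 1, h⟩) ≤ D

/-- Bound on `‖∇(A*_p - A_{θ,p})²‖² / 4` for each weight matrix when all of them have squared
Frobenius norm at most `K` and `(A*_p)² ≤ C₁`. -/
def gradBound (L : ℕ) (C₁ K : ℝ) : ℝ := 2 * (C₁ + K ^ L) * K ^ (L - 1)

lemma gradBound_nonneg {L : ℕ} {C₁ K : ℝ} (hC₁ : 0 ≤ C₁) (hK : 0 ≤ K) : 0 ≤ gradBound L C₁ K := by
  unfold gradBound; positivity

lemma gradBound_mono {L : ℕ} {C₁ K K' : ℝ} (hC₁ : 0 ≤ C₁) (hK : 0 ≤ K) (h : K ≤ K') :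
    gradBound L C₁ K ≤ gradBound L C₁ K' := by
  have : 0 ≤ K' := hK.trans h
  unfold gradBound; gcongr

section Step

variable {L : ℕ} {w : ℕ → ℕ} {θ : Params L w} {p : Fin (w L) × Fin (w 0)}
  {f b : ∀ k, EuclideanSpace ℝ (Fin (w k))} {K C₁ lam η : ℝ}
  {Astar : Matrix (Fin (w L)) (Fin (w 0)) ℝ}

lemma IsPath.norm_f_le (h : IsPath θ p f b) (hK0 : 0 ≤ K) (hK : ∀ l, frobSq (θ l) ≤ K) {k : ℕ}
    (hk : k ≤ L) : ‖f k‖ ≤ √K ^ k := by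
  have := h.forward.norm_le (frobSq_weight_le hK0 hK) (Nat.zero_le k) hk
  rwa [h.f_zero, OrthonormalBasis.norm_eq_one, mul_one] at this

lemma IsPath.norm_b_le (h : IsPath θ p f b) (hK0 : 0 ≤ K) (hK : ∀ l, frobSq (θ l) ≤ K) {k : ℕ}
    (hk : k ≤ L) : ‖b k‖ ≤ √K ^ (L - k) := by
  have := h.backward.norm_le (frobSq_weight_le hK0 hK) (Nat.zero_le k) hk
  rwa [h.b_last, OrthonormalBasis.norm_eq_one, mul_one] at this

lemma IsPath.norm_sq_mul_le (h : IsPath θ p f b) (hK0 : 0 ≤ K) (hK : ∀ l, frobSq (θ l) ≤ K)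
    {k : ℕ} (hk : k < L) : ‖b (k + 1)‖ ^ 2 * ‖f k‖ ^ 2 ≤ K ^ (L - 1) := by
  have h1 := h.norm_f_le hK0 hK hk.le
  have h2 := h.norm_b_le hK0 hK hk
  calc ‖b (k + 1)‖ ^ 2 * ‖f k‖ ^ 2 ≤ (√K ^ (L - (k + 1))) ^ 2 * (√K ^ k) ^ 2 := by gcongr
    _ = (√K ^ 2) ^ (L - 1) := by
      rw [← mul_pow, ← pow_add, ← pow_mul, ← pow_mul]; congr 1
      rw [mul_comm]; congr 1; omega
    _ = K ^ (L - 1) := by rw [Real.sq_sqrt hK0]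

lemma residual_sq_le (hK0 : 0 ≤ K) (hK : ∀ l, frobSq (θ l) ≤ K)
    (hA : Astar p.1 p.2 ^ 2 ≤ C₁) :
    (Astar p.1 p.2 - netMatrix θ p.1 p.2) ^ 2 ≤ 2 * (C₁ + K ^ L) := by
  obtain ⟨f, b, h⟩ := exists_isPath θ p
  have h1 : |netMatrix θ p.1 p.2| ≤ √K ^ L := by
    rw [← h.inner_eq le_rfl, h.b_last]
    refine (abs_real_inner_le_norm _ _).trans ?_
    rw [OrthonormalBasis.norm_eq_one, one_mul]
    exact h.norm_f_le hK0 hK le_rfl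
  have h2 : netMatrix θ p.1 p.2 ^ 2 ≤ K ^ L := by
    calc netMatrix θ p.1 p.2 ^ 2 = |netMatrix θ p.1 p.2| ^ 2 := (sq_abs _).symm
      _ ≤ (√K ^ L) ^ 2 := by gcongr
      _ = K ^ L := by rw [← pow_mul, mul_comm, pow_mul, Real.sq_sqrt hK0]
  nlinarith [sq_nonneg (Astar p.1 p.2 + netMatrix θ p.1 p.2)]

lemma IsPath.gradient_sq_le (h : IsPath θ p f b) (hK0 : 0 ≤ K) (hK : ∀ l, frobSq (θ l) ≤ K)
    (hA : Astar p.1 p.2 ^ 2 ≤ C₁) {k : ℕ} (hk : k < L) :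
    (Astar p.1 p.2 - netMatrix θ p.1 p.2) ^ 2 * (‖b (k + 1)‖ ^ 2 * ‖f k‖ ^ 2)
      ≤ gradBound L C₁ K := by
  have h1 := residual_sq_le hK0 hK hA
  have h2 := h.norm_sq_mul_le hK0 hK hk
  exact mul_le_mul h1 h2 (by positivity) ((sq_nonneg _).trans h1)

/-- The first order effect of the gradient on `‖W_l‖_F²` is `(A* - A) A ≤ (A*)² / 4`, whatever
the layer. -/
lemma frobSq_sgdStep_le (hη : 0 ≤ η) (hx : η * lam ≤ 1) (hK0 : 0 ≤ K)
    (hK : ∀ l, frobSq (θ l) ≤ K) (hA : Astar p.1 p.2 ^ 2 ≤ C₁) (l : Fin L) :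
    frobSq (sgdStep Astar lam η p θ l)
      ≤ (1 - η * lam) ^ 2 * K + (1 - η * lam) * η * (C₁ / 2) + η ^ 2 * gradBound L C₁ K := by
  obtain ⟨f, b, h⟩ := exists_isPath θ p
  rw [h.sgdStep_eq, frobSq_add_vecMulVec, h.op_f, h.inner_eq l.2]
  have h1 := h.gradient_sq_le hK0 hK hA l.2
  set ρ := Astar p.1 p.2 - netMatrix θ p.1 p.2 with hρ
  have h2 : ρ * netMatrix θ p.1 p.2 ≤ C₁ / 4 := by
    nlinarith [sq_nonneg (Astar p.1 p.2 - 2 * netMatrix θ p.1 p.2)]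
  have h3 : 0 ≤ (1 - η * lam) * η := mul_nonneg (by linarith) hη
  have h4 := mul_le_mul_of_nonneg_left h2 h3
  have h5 := mul_le_mul_of_nonneg_left h1 (sq_nonneg η)
  have h6 := mul_le_mul_of_nonneg_left (hK l) (sq_nonneg (1 - η * lam))
  nlinarith

/-- The first order effects of the gradient on `W_l W_lᵀ` and on `W_{l+1}ᵀ W_{l+1}` cancel, so
that the balance defect changes only to second order in `η`, up to the contraction by weight
decay. -/
lemma IsBalanced.sgdStep {D : ℝ} (hD : IsBalanced θ D) (hC₁ : 0 ≤ C₁) (hD0 : 0 ≤ D) (hK0 : 0 ≤ K)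
    (hK : ∀ l, frobSq (θ l) ≤ K) (hA : Astar p.1 p.2 ^ 2 ≤ C₁) :
    IsBalanced (sgdStep Astar lam η p θ)
      ((1 - η * lam) ^ 2 * D + η ^ 2 * gradBound L C₁ K) := by
  intro l hl
  obtain ⟨f, b, h⟩ := exists_isPath θ p
  have hg := gradBound_nonneg (L := L) hC₁ hK0
  refine specNorm_le (defect_transpose _ _) (by positivity) fun x => ?_
  rw [inner_op_defect, h.sgdStep_eq, h.sgdStep_eq, transpose_add_vecMulVec, op_add_vecMulVec,
    op_add_vecMulVec]
  have hf := h.op_f ⟨l, Nat.lt_of_succ_lt hl⟩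
  have hb := h.op_transpose_b ⟨l + 1, hl⟩
  have g1 := h.gradient_sq_le hK0 hK hA (Nat.lt_of_succ_lt hl)
  have g2 := h.gradient_sq_le hK0 hK hA hl
  have hdef := (abs_inner_op_le_specNorm _ x).trans
    (mul_le_mul_of_nonneg_right (hD l hl) (sq_nonneg ‖x‖))
  rw [inner_op_defect] at hdef
  simp only at hf hb ⊢
  generalize θ ⟨l, Nat.lt_of_succ_lt hl⟩ = W at *
  generalize θ ⟨l + 1, hl⟩ = V at *
  set ρ := Astar p.1 p.2 - netMatrix θ p.1 p.2
  set c := 1 - η * lam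
  have e1 : ⟪op W.transpose x, f l⟫ = ⟪f (l + 1), x⟫ := by
    rw [inner_op, Matrix.transpose_transpose, hf, real_inner_comm]
  have e2 : ⟪op V x, b (l + 1 + 1)⟫ = ⟪b (l + 1), x⟫ := by
    rw [inner_op, hb, real_inner_comm]
  rw [norm_add_sq_real, norm_add_sq_real, norm_smul, norm_smul, norm_smul, norm_smul,
    real_inner_smul_left, real_inner_smul_left, real_inner_smul_right, real_inner_smul_right, e1,
    e2, mul_pow, mul_pow, mul_pow, mul_pow]
  simp only [Real.norm_eq_abs, sq_abs]
  set P := ⟪b (l + 1), x⟫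
  set Q := ⟪f (l + 1), x⟫
  have hP : P ^ 2 ≤ ‖b (l + 1)‖ ^ 2 * ‖x‖ ^ 2 := by
    rw [← mul_pow, ← sq_abs P]; gcongr; exact abs_real_inner_le_norm _ _
  have hQ : Q ^ 2 ≤ ‖f (l + 1)‖ ^ 2 * ‖x‖ ^ 2 := by
    rw [← mul_pow, ← sq_abs Q]; gcongr; exact abs_real_inner_le_norm _ _
  have hP' : (η * ρ * P) ^ 2 * ‖f l‖ ^ 2 ≤ η ^ 2 * gradBound L C₁ K * ‖x‖ ^ 2 := by
    calc (η * ρ * P) ^ 2 * ‖f l‖ ^ 2 = η ^ 2 * ρ ^ 2 * ‖f l‖ ^ 2 * P ^ 2 := by ring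
      _ ≤ η ^ 2 * ρ ^ 2 * ‖f l‖ ^ 2 * (‖b (l + 1)‖ ^ 2 * ‖x‖ ^ 2) := by gcongr
      _ = η ^ 2 * (ρ ^ 2 * (‖b (l + 1)‖ ^ 2 * ‖f l‖ ^ 2)) * ‖x‖ ^ 2 := by ring
      _ ≤ _ := by gcongr
  have hQ' : (η * ρ * Q) ^ 2 * ‖b (l + 1 + 1)‖ ^ 2 ≤ η ^ 2 * gradBound L C₁ K * ‖x‖ ^ 2 := by
    calc (η * ρ * Q) ^ 2 * ‖b (l + 1 + 1)‖ ^ 2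
        = η ^ 2 * ρ ^ 2 * ‖b (l + 1 + 1)‖ ^ 2 * Q ^ 2 := by ring
      _ ≤ η ^ 2 * ρ ^ 2 * ‖b (l + 1 + 1)‖ ^ 2 * (‖f (l + 1)‖ ^ 2 * ‖x‖ ^ 2) := by gcongr
      _ = η ^ 2 * (ρ ^ 2 * (‖b (l + 1 + 1)‖ ^ 2 * ‖f (l + 1)‖ ^ 2)) * ‖x‖ ^ 2 := by ring
      _ ≤ _ := by gcongr
  have hP0 : 0 ≤ (η * ρ * P) ^ 2 * ‖f l‖ ^ 2 := by positivity
  have hQ0 : 0 ≤ (η * ρ * Q) ^ 2 * ‖b (l + 1 + 1)‖ ^ 2 := by positivity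
  obtain ⟨d1, d2⟩ := abs_le.1 hdef
  have d1' := mul_le_mul_of_nonneg_left d1 (sq_nonneg c)
  have d2' := mul_le_mul_of_nonneg_left d2 (sq_nonneg c)
  rw [abs_le]
  constructor <;> linarith

/-- A balance defect is a difference of positive matrices, each bounded by the Frobenius norms. -/
lemma isBalanced_of_frobSq_le (hK0 : 0 ≤ K) (hK : ∀ l, frobSq (θ l) ≤ K) : IsBalanced θ K := by
  intro l hl
  refine specNorm_le (defect_transpose _ _) hK0 fun x => ?_
  rw [inner_op_defect]
  have h1 := (norm_op_sq_le (θ ⟨l, Nat.lt_of_succ_lt hl⟩).transpose x).trans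
    (mul_le_mul_of_nonneg_right ((frobSq_transpose _).trans_le (hK _)) (sq_nonneg ‖x‖))
  have h2 := (norm_op_sq_le (θ ⟨l + 1, hl⟩) x).trans
    (mul_le_mul_of_nonneg_right (hK _) (sq_nonneg ‖x‖))
  rw [abs_le]
  constructor <;> nlinarith [sq_nonneg ‖op (θ ⟨l + 1, hl⟩) x‖,
    sq_nonneg ‖op (θ ⟨l, Nat.lt_of_succ_lt hl⟩).transpose x‖]

lemma IsBalanced.mono {D D' : ℝ} (h : IsBalanced θ D) (hD : D ≤ D') : IsBalanced θ D' :=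
  fun l hl => (h l hl).trans hD

end Step

/-! ### Approximate eigenvectors in approximately balanced networks -/

/-- Growth of the norms `y m` of an approximate eigenvector that is propagated through
approximately balanced layers; `R m` is its eigenvector residual. -/
lemma approx_eigenvector_growth {N : ℕ} {y R : ℕ → ℝ} {s ε γ : ℝ} (hs : 0 ≤ s) (hε : 0 ≤ ε)
    (hγ : 0 ≤ γ) (hsγ : s ≤ γ ^ 2) (hy : ∀ m, 0 ≤ y m) (hy0 : y 0 = 1)
    (hR0 : R 0 = 0) (h1 : ∀ m < N, y (m + 1) ^ 2 ≤ s * y m ^ 2 + y m * (R m + ε * y m))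
    (h2 : ∀ m, m + 1 < N → R (m + 1) ≤ γ * (R m + ε * y m))
    (h3 : ∀ m < N, y (m + 1) ≤ γ * y m) :
    y N ≤ √s ^ N + N * γ ^ (N - 1) * √ε := by
  have hyγ : ∀ m ≤ N, y m ≤ γ ^ m := by
    intro m
    induction m with
    | zero => intro _; simp [hy0]
    | succ m ih =>
      intro hm
      rw [pow_succ']
      exact (h3 m hm).trans (mul_le_mul_of_nonneg_left (ih (by omega)) hγ)
  have hRγ : ∀ m < N, R m ≤ m * ε * γ ^ m := by
    intro m
    induction m with
    | zero => intro _; simp [hR0]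
    | succ m ih =>
      intro hm
      refine (h2 m hm).trans ?_
      have e1 := ih (by omega)
      have e2 := mul_le_mul_of_nonneg_left (hyγ m (by omega)) hε
      calc γ * (R m + ε * y m) ≤ γ * (m * ε * γ ^ m + ε * γ ^ m) := by gcongr
        _ = _ := by push_cast; ring
  have key : ∀ m ≤ N, y m ^ 2 ≤ s ^ m + m ^ 2 * (γ ^ (m - 1)) ^ 2 * ε := by
    intro m
    induction m with
    | zero => intro _; simp [hy0]
    | succ m ih =>
      intro hm
      have e1 := ih (by omega)
      have e2 := hyγ m (by omega)
      have e3 := hRγ m hm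
      have e4 := mul_le_mul_of_nonneg_left e2 hε
      have e5 : y m * (R m + ε * y m) ≤ γ ^ m * (m * ε * γ ^ m + ε * γ ^ m) :=
        (mul_le_mul_of_nonneg_left (add_le_add e3 e4) (hy m)).trans
          (mul_le_mul_of_nonneg_right e2 (by positivity))
      have e6 : s * ((m : ℝ) ^ 2 * (γ ^ (m - 1)) ^ 2 * ε) ≤ (m : ℝ) ^ 2 * (γ ^ m) ^ 2 * ε := by
        rcases Nat.eq_zero_or_pos m with rfl | hm0
        · simp
        · obtain ⟨j, rfl⟩ := Nat.exists_eq_succ_of_ne_zero hm0.ne'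
          calc s * (((j.succ : ℕ) : ℝ) ^ 2 * (γ ^ (j.succ - 1)) ^ 2 * ε)
              ≤ γ ^ 2 * (((j.succ : ℕ) : ℝ) ^ 2 * (γ ^ (j.succ - 1)) ^ 2 * ε) := by gcongr
            _ = _ := by rw [Nat.succ_sub_one, Nat.succ_eq_add_one, pow_succ γ j]; ring
      have e7 := mul_le_mul_of_nonneg_left e1 hs
      have e8 : 0 ≤ (m : ℝ) * ((γ ^ m) ^ 2 * ε) := by positivity
      have e9 := h1 m hm
      rw [Nat.add_sub_cancel, pow_succ s]
      push_cast
      nlinarith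
  refine le_of_sq_le_sq ((key N le_rfl).trans ?_) (by positivity)
  have h4 : s ^ N = (√s ^ N) ^ 2 := by rw [← pow_mul, mul_comm, pow_mul, Real.sq_sqrt hs]
  have h5 : (N : ℝ) ^ 2 * (γ ^ (N - 1)) ^ 2 * ε = (N * γ ^ (N - 1) * √ε) ^ 2 := by
    rw [mul_pow, mul_pow, Real.sq_sqrt hε]
  have h6 : 0 ≤ √s ^ N * (N * γ ^ (N - 1) * √ε) := by positivity
  rw [h4, h5]
  nlinarith

section Propagation

variable {L : ℕ} {w : ℕ → ℕ} {θ : Params L w} {C ε s : ℝ}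

/-- The deviation from balance at layer `k`, applied to a vector. -/
lemma norm_defect_le (hbal : IsBalanced θ ε) {k : ℕ} (hk : k + 1 < L)
    (x : EuclideanSpace ℝ (Fin (w (k + 1)))) :
    ‖op (weight θ k) (op (weight θ k).transpose x)
      - op (weight θ (k + 1)).transpose (op (weight θ (k + 1)) x)‖ ≤ ε * ‖x‖ := by
  rw [weight_of_lt θ (Nat.lt_of_succ_lt hk), weight_of_lt θ hk, ← op_mul_apply, ← op_mul_apply,
    ← LinearMap.sub_apply, ← map_sub]
  exact (norm_op_le_specNorm _ x).trans (mul_le_mul_of_nonneg_right (hbal k hk) (norm_nonneg x))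

/-- The residual of `x` as an eigenvector of `W_kᵀ W_k`. -/
noncomputable def eigenResidual (θ : Params L w) (s : ℝ) (k : ℕ) (x : EuclideanSpace ℝ (Fin (w k))) :
    EuclideanSpace ℝ (Fin (w k)) :=
  op (weight θ k).transpose (op (weight θ k) x) - s • x

lemma norm_op_weight_sq (k : ℕ) (x : EuclideanSpace ℝ (Fin (w k))) :
    ‖op (weight θ k) x‖ ^ 2 ≤ s * ‖x‖ ^ 2 + ‖x‖ * ‖eigenResidual θ s k x‖ := by
  have h : ‖op (weight θ k) x‖ ^ 2 = s * ‖x‖ ^ 2 + ⟪x, eigenResidual θ s k x⟫ := by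
    rw [eigenResidual, inner_sub_right, real_inner_smul_right, real_inner_self_eq_norm_sq,
      ← inner_op, real_inner_self_eq_norm_sq]
    ring
  rw [h]
  gcongr
  exact real_inner_le_norm _ _

lemma norm_forward_le (hC : 0 ≤ C) (hK : ∀ l, frobSq (θ l) ≤ C) (hε : 0 ≤ ε)
    (hbal : IsBalanced θ ε) (hs : 0 ≤ s) (hsC : s ≤ C) {l : ℕ} (hl : l ≤ L)
    {z : ∀ k, EuclideanSpace ℝ (Fin (w k))} (hz : IsForward (weight θ) l L z) (hz1 : ‖z l‖ = 1)
    (hres : eigenResidual θ s l (z l) = 0) :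
    ‖z L‖ ≤ √s ^ (L - l) + (L - l : ℕ) * √C ^ (L - l - 1) * √ε := by
  have hW := frobSq_weight_le hC hK
  have hstep : ∀ m, m < L - l → z (l + (m + 1)) = op (weight θ (l + m)) (z (l + m)) :=
    fun m hm => hz (l + m) (by omega) (by omega)
  have := approx_eigenvector_growth (N := L - l) (y := fun m => ‖z (l + m)‖)
    (R := fun m => ‖eigenResidual θ s (l + m) (z (l + m))‖) hs hε (Real.sqrt_nonneg C)
    (by rwa [Real.sq_sqrt hC]) (fun _ => norm_nonneg _) hz1 (by simpa using hres)
    (fun m hm => ?_) (fun m hm => ?_) (fun m hm => ?_)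
  · have e : ∀ k, k = L → ‖z k‖ = ‖z L‖ := by rintro _ rfl; rfl
    rwa [e _ (Nat.add_sub_cancel' hl)] at this
  · rw [hstep m hm]
    refine (norm_op_weight_sq (s := s) _ _).trans ?_
    gcongr
    exact le_add_of_nonneg_right (by positivity)
  · rw [hstep m (by omega)]
    have e : eigenResidual θ s (l + (m + 1)) (op (weight θ (l + m)) (z (l + m)))
        = op (weight θ (l + m)) (eigenResidual θ s (l + m) (z (l + m)))
          - (op (weight θ (l + m)) (op (weight θ (l + m)).transpose
              (op (weight θ (l + m)) (z (l + m))))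
            - op (weight θ (l + m + 1)).transpose (op (weight θ (l + m + 1))
              (op (weight θ (l + m)) (z (l + m))))) := by
      simp only [eigenResidual, map_sub, map_smul]
      change op (weight θ (l + m + 1)).transpose (op (weight θ (l + m + 1)) _) - _ = _
      abel
    rw [e]
    refine (norm_sub_le _ _).trans ?_
    have e1 := norm_op_le (hW (l + m)) (eigenResidual θ s (l + m) (z (l + m)))
    have e2 := norm_defect_le hbal (k := l + m) (by omega) (op (weight θ (l + m)) (z (l + m)))
    have e3 := mul_le_mul_of_nonneg_left (norm_op_le (hW (l + m)) (z (l + m))) hε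
    nlinarith
  · rw [hstep m hm]
    exact norm_op_le (hW _) _

lemma norm_backward_le (hC : 0 ≤ C) (hK : ∀ l, frobSq (θ l) ≤ C) (hε : 0 ≤ ε)
    (hbal : IsBalanced θ ε) (hs : 0 ≤ s) (hsC : s ≤ C) {l : ℕ} (hl : l < L)
    {y : ∀ k, EuclideanSpace ℝ (Fin (w k))} (hy : IsBackward (weight θ) 0 l y) (hy1 : ‖y l‖ = 1)
    (hres : eigenResidual θ s l (y l) = 0) :
    ‖y 0‖ ≤ √s ^ l + l * √C ^ (l - 1) * √ε := by
  have hW : ∀ k, frobSq (weight θ k).transpose ≤ C := fun k =>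
    (frobSq_transpose _).trans_le (frobSq_weight_le hC hK k)
  have hE : ∀ k < l, ‖op (weight θ k) (op (weight θ k).transpose (y (k + 1))) - s • y (k + 1)‖
      ≤ ‖eigenResidual θ s (k + 1) (y (k + 1))‖ + ε * ‖y (k + 1)‖ := fun k hk => by
    have e : op (weight θ k) (op (weight θ k).transpose (y (k + 1))) - s • y (k + 1)
        = eigenResidual θ s (k + 1) (y (k + 1))
          + (op (weight θ k) (op (weight θ k).transpose (y (k + 1)))
            - op (weight θ (k + 1)).transpose (op (weight θ (k + 1)) (y (k + 1)))) := by
      rw [eigenResidual]; abel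
    rw [e]
    exact (norm_add_le _ _).trans (add_le_add le_rfl (norm_defect_le hbal (by omega) _))
  have h1 : ∀ k < l, ‖y k‖ ^ 2 ≤ s * ‖y (k + 1)‖ ^ 2
      + ‖y (k + 1)‖ * (‖eigenResidual θ s (k + 1) (y (k + 1))‖ + ε * ‖y (k + 1)‖) := fun k hk => by
    have e : ‖y k‖ ^ 2 = s * ‖y (k + 1)‖ ^ 2 + ⟪y (k + 1),
        op (weight θ k) (op (weight θ k).transpose (y (k + 1))) - s • y (k + 1)⟫ := by
      rw [inner_sub_right, real_inner_smul_right, real_inner_self_eq_norm_sq, real_inner_comm,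
        inner_op, real_inner_self_eq_norm_sq, ← hy k (Nat.zero_le _) hk]
      ring
    rw [e]
    gcongr
    exact (real_inner_le_norm _ _).trans (mul_le_mul_of_nonneg_left (hE k hk) (norm_nonneg _))
  have h2 : ∀ k < l, ‖eigenResidual θ s k (y k)‖
      ≤ √C * (‖eigenResidual θ s (k + 1) (y (k + 1))‖ + ε * ‖y (k + 1)‖) := fun k hk => by
    have e : eigenResidual θ s k (y k) = op (weight θ k).transpose
        (op (weight θ k) (op (weight θ k).transpose (y (k + 1))) - s • y (k + 1)) := by
      rw [eigenResidual, map_sub, map_smul, ← hy k (Nat.zero_le _) hk]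
    rw [e]
    exact (norm_op_le (hW k) _).trans
      (mul_le_mul_of_nonneg_left (hE k hk) (Real.sqrt_nonneg _))
  have h3 : ∀ k < l, ‖y k‖ ≤ √C * ‖y (k + 1)‖ := fun k hk => by
    rw [hy k (Nat.zero_le _) hk]; exact norm_op_le (hW k) _
  have hidx : ∀ m < l, l - m = l - (m + 1) + 1 := fun m hm => by omega
  have := approx_eigenvector_growth (N := l) (y := fun m => ‖y (l - m)‖)
    (R := fun m => ‖eigenResidual θ s (l - m) (y (l - m))‖) hs hε (Real.sqrt_nonneg C)
    (by rwa [Real.sq_sqrt hC]) (fun _ => norm_nonneg _) hy1 (by simpa using hres)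
    (fun m hm => ?_) (fun m hm => ?_) (fun m hm => ?_)
  · have e : ∀ k, k = 0 → ‖y k‖ = ‖y 0‖ := by rintro _ rfl; rfl
    rwa [e _ (Nat.sub_self l)] at this
  · rw [hidx m hm]
    exact h1 _ (by omega)
  · rw [hidx m (by omega)]
    exact h2 _ (by omega)
  · rw [hidx m hm]
    exact h3 _ (by omega)

/-- At an eigenvector `q` of `W_lᵀ W_l` with eigenvalue `s`, the gradient behaves as for exactly
balanced weights, where all factors contribute the same singular value `√s`. -/
lemma IsPath.abs_inner_mul_le {p : Fin (w L) × Fin (w 0)} {f b : ∀ k, EuclideanSpace ℝ (Fin (w k))}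
    (h : IsPath θ p f b) (hC : 0 ≤ C) (hK : ∀ l, frobSq (θ l) ≤ C) (hε : 0 ≤ ε)
    (hbal : IsBalanced θ ε) (l : Fin L) {q : EuclideanSpace ℝ (Fin (w l))} (hq : ‖q‖ = 1)
    (hs : 0 ≤ s) (heig : op ((θ l).transpose * θ l) q = s • q) :
    |⟪b (l + 1), op (θ l) q⟫| * |⟪f l, q⟫| ≤ √s ^ L + L * √C ^ (L - 1) * √ε := by
  obtain ⟨z, hz0, hz⟩ := exists_isForward (weight θ) l L q
  obtain ⟨y, hy0, hy⟩ := exists_isBackward (weight θ) l q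
  have hl := l.2
  have hres : eigenResidual θ s l q = 0 := by
    rw [eigenResidual, weight_of_lt θ l.2, ← op_mul_apply, sub_eq_zero]; exact heig
  have hsC : s ≤ C := by
    have h1 := norm_op_sq_le (θ l) q
    rw [← real_inner_self_eq_norm_sq, ← inner_op_gram, heig, real_inner_smul_right,
      real_inner_self_eq_norm_sq, hq] at h1
    linarith [hK l]
  have ha : |⟪f l, q⟫| ≤ ‖y 0‖ := by
    rw [← hy0, real_inner_comm, ← inner_backward_forward hy
      (fun k h1 h2 => h.forward k h1 (by omega)) le_rfl (Nat.zero_le _), h.f_zero]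
    refine (abs_real_inner_le_norm _ _).trans ?_
    rw [OrthonormalBasis.norm_eq_one, mul_one]
  have hb : |⟪b (l + 1), op (θ l) q⟫| ≤ ‖z L‖ := by
    have e : op (θ l) q = z (l + 1) := by rw [hz l le_rfl l.2, hz0, weight_of_lt θ l.2]
    rw [e, inner_backward_forward (m := l + 1) (N := L)
      (fun k h1 h2 => h.backward k (Nat.zero_le _) h2)
      (fun k h1 h2 => hz k (by omega) h2) le_rfl l.2, h.b_last]
    refine (abs_real_inner_le_norm _ _).trans ?_
    rw [OrthonormalBasis.norm_eq_one, one_mul]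
  have hzL := norm_forward_le hC hK hε hbal hs hsC l.2.le hz (by rw [hz0, hq])
    (by rw [hz0]; exact hres)
  have hzL' : ‖z L‖ ≤ √C ^ (L - l) := by
    have := hz.norm_le (frobSq_weight_le hC hK) l.2.le le_rfl
    rwa [hz0, hq, mul_one] at this
  have hy' := norm_backward_le hC hK hε hbal hs hsC l.2 hy (by rw [hy0, hq])
    (by rw [hy0]; exact hres)
  have hσ : √s ≤ √C := Real.sqrt_le_sqrt hsC
  -- split off the error of the smaller factor first, so that no product of errors appears
  calc |⟪b (l + 1), op (θ l) q⟫| * |⟪f l, q⟫|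
      ≤ ‖z L‖ * (√s ^ l.1 + l.1 * √C ^ (l.1 - 1) * √ε) := by
        gcongr; exact ha.trans hy'
    _ ≤ (√s ^ (L - l) + (L - l : ℕ) * √C ^ (L - l - 1) * √ε) * √s ^ l.1
        + √C ^ (L - l) * (l.1 * √C ^ (l.1 - 1) * √ε) := by
        rw [mul_add]; gcongr
    _ ≤ (√s ^ (L - l) * √s ^ l.1 + (L - l : ℕ) * √C ^ (L - l - 1) * √ε * √C ^ l.1)
        + √C ^ (L - l) * (l.1 * √C ^ (l.1 - 1) * √ε) := by
        rw [add_mul]; gcongr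
    _ = √s ^ L + L * √C ^ (L - 1) * √ε := by
        have e1 : √s ^ (L - l) * √s ^ l.1 = √s ^ L := by rw [← pow_add]; congr 1; omega
        have e2 : √C ^ (L - l - 1) * √C ^ l.1 = √C ^ (L - 1) := by
          rw [← pow_add]; congr 1; omega
        have e3 : √C ^ (L - l) * (l.1 * √C ^ (l.1 - 1)) = l.1 * √C ^ (L - 1) := by
          rcases Nat.eq_zero_or_pos l.1 with h0 | h0
          · simp [h0]
          · rw [mul_left_comm, ← pow_add]; congr 2; omega
        rw [e1, Nat.cast_sub l.2.le]
        linear_combination ((L : ℝ) - l.1) * √ε * e2 + √ε * e3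

end Propagation

/-! ### The drift of the approximate rank -/

lemma fAlpha_nonneg {α x : ℝ} (hα : 0 < α) (hx : 0 ≤ x) : 0 ≤ fAlpha α x := by
  by_cases h : x ≤ α
  · rw [fAlpha_eq hα h]
    have h1 : x / α ≤ 1 := (div_le_one hα).2 h
    have h2 : 0 ≤ x / α := by positivity
    nlinarith
  · rw [fAlpha, if_neg h]; exact zero_le_one

/-- The drift of one eigenvalue `s` under weight decay `lam` and a gradient of size
`Q √s ^ L`. The bound on `α` makes weight decay win below `α`, with a margin that is
proportional to the distance of `f_α s` to the integers. -/
lemma fAlphaDeriv_drift {α s lam Q : ℝ} {L : ℕ} (hL : 3 ≤ L) (hα : 0 < α) (hs : 0 ≤ s)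
    (hlam : 0 ≤ lam) (hQ : 0 ≤ Q) (hQα : Q * √α ^ (L - 2) ≤ lam) :
    fAlphaDeriv α s * (Q * √s ^ L - lam * s)
      ≤ -(lam / 6) * min (fAlpha α s) (1 - fAlpha α s) := by
  by_cases hsα : s ≤ α
  · obtain ⟨k, rfl⟩ : ∃ k, L = k + 3 := ⟨L - 3, by omega⟩
    have h1 : 0 ≤ √s := Real.sqrt_nonneg s
    have h2 : √s ≤ √α := Real.sqrt_le_sqrt hsα
    have hα' : 0 < √α := Real.sqrt_pos.2 hα
    set v := √s / √α with hv
    have hv0 : 0 ≤ v := by positivity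
    have hv1 : v ≤ 1 := (div_le_one hα').2 h2
    have hsv : √s = v * √α := by rw [hv]; field_simp
    have ht : s / α = v ^ 2 := by
      rw [hv, div_pow, Real.sq_sqrt hs, Real.sq_sqrt hα.le]
    have hgrad : Q * √s ^ (k + 3) ≤ lam * s * v := by
      have e1 : √s ^ (k + 3) = s * (√s ^ k * √s) := by
        conv_rhs => rw [← Real.sq_sqrt hs]
        rw [Real.sqrt_sq h1]; ring
      have e2 : √s ^ k ≤ √α ^ k := by gcongr
      have e3 : k + 3 - 2 = k + 1 := by omega
      rw [e3, pow_succ] at hQα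
      calc Q * √s ^ (k + 3) = Q * s * (√s ^ k * √s) := by rw [e1]; ring
        _ ≤ Q * s * (√α ^ k * √s) := by gcongr
        _ = s * v * (Q * (√α ^ k * √α)) := by rw [hsv]; ring
        _ ≤ s * v * lam := by gcongr
        _ = _ := by ring
    have hd : fAlphaDeriv α s * s = 2 * v ^ 2 * (1 - v ^ 2) := by
      rw [← ht, fAlphaDeriv, if_pos hsα]; field_simp
    have hmin : min (fAlpha α s) (1 - fAlpha α s) ≤ 6 * (2 * v ^ 2 * (1 - v ^ 2) * (1 - v)) := by
      rw [fAlpha_eq hα hsα, ht]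
      have hv2 : v ^ 2 ≤ 1 := by nlinarith
      have hv3 : 1 - v ^ 2 ≤ 2 * (1 - v) := by nlinarith
      have hbase : v ^ 2 * (1 - v ^ 2) ^ 2 ≤ 2 * v ^ 2 * (1 - v ^ 2) * (1 - v) := by
        have := mul_le_mul_of_nonneg_left hv3
          (mul_nonneg (sq_nonneg v) (sub_nonneg.2 hv2))
        linarith
      refine le_trans ?_ (mul_le_mul_of_nonneg_left hbase (by norm_num))
      have ht0 : 0 ≤ v ^ 2 := sq_nonneg v
      generalize v ^ 2 = t at *
      rcases le_total t (1 / 2) with ht2 | ht2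
      · refine (min_le_left _ _).trans ?_
        have : 0 ≤ (1 - 2 * t) * (4 - 3 * t) := mul_nonneg (by linarith) (by linarith)
        nlinarith
      · refine (min_le_right _ _).trans ?_
        nlinarith [sq_nonneg (1 - t)]
    have hd0 := fAlphaDeriv_nonneg (α := α) s
    calc fAlphaDeriv α s * (Q * √s ^ (k + 3) - lam * s)
        ≤ fAlphaDeriv α s * (lam * s * v - lam * s) := by gcongr
      _ = -(lam / 6) * (6 * (fAlphaDeriv α s * s * (1 - v))) := by ring
      _ = -(lam / 6) * (6 * (2 * v ^ 2 * (1 - v ^ 2) * (1 - v))) := by rw [hd]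
      _ ≤ _ := by
        have := mul_le_mul_of_nonneg_left hmin (by positivity : 0 ≤ lam / 6)
        linarith
  · have h1 : fAlpha α s = 1 := if_neg hsα
    have h2 : fAlphaDeriv α s = 0 := if_neg hsα
    rw [h1, h2]; simp

/-- If a sum of numbers in `[0, 1]` lies strictly between two integers, then the distances of
these numbers to the integers add up to at least the distance of the sum to the integers. -/
lemma le_sum_min {ι : Type*} [Fintype ι] {F : ι → ℝ} (h0 : ∀ i, 0 ≤ F i) (h1 : ∀ i, F i ≤ 1)
    {r : ℕ} {δ : ℝ} (hl : r + δ ≤ ∑ i, F i) (hu : ∑ i, F i ≤ r + 1 - δ) :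
    δ ≤ ∑ i, min (F i) (1 - F i) := by
  classical
  set S : Finset ι := Finset.univ.filter fun i => 1 / 2 < F i
  have e1 : ∑ i, min (F i) (1 - F i) = ∑ i ∈ S, (1 - F i) + ∑ i ∈ Sᶜ, F i := by
    rw [← Finset.sum_add_sum_compl S]
    congr 1 <;> refine Finset.sum_congr rfl fun i hi => ?_
    · have : 1 / 2 < F i := by simpa [S] using hi
      rw [min_eq_right]; linarith
    · have : F i ≤ 1 / 2 := by simpa [S] using hi
      rw [min_eq_left]; linarith
  have e2 : ∑ i ∈ S, (1 - F i) = S.card - ∑ i ∈ S, F i := by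
    rw [Finset.sum_sub_distrib]; simp
  have e3 := Finset.sum_add_sum_compl S F
  have e4 : 0 ≤ ∑ i ∈ Sᶜ, F i := Finset.sum_nonneg fun i _ => h0 i
  have e5 : 0 ≤ ∑ i ∈ S, (1 - F i) := Finset.sum_nonneg fun i _ => sub_nonneg.2 (h1 i)
  rcases Nat.lt_or_ge r S.card with h | h
  · have : (r : ℝ) + 1 ≤ S.card := by exact_mod_cast h
    linarith
  · have : (S.card : ℝ) ≤ r := by exact_mod_cast h
    linarith

section ApproxRank

variable {L : ℕ} {w : ℕ → ℕ} {θ : Params L w} {p : Fin (w L) × Fin (w 0)} {C C₁ lam η : ℝ}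
  {Astar : Matrix (Fin (w L)) (Fin (w 0)) ℝ}

/-- The second order effect of a step on the Gram matrix of `W_l`, traced out. -/
lemma sum_norm_increment_sq_le {f b : ∀ k, EuclideanSpace ℝ (Fin (w k))} (h : IsPath θ p f b)
    (hC : 0 ≤ C) (hK : ∀ l, frobSq (θ l) ≤ C)
    (hA : Astar p.1 p.2 ^ 2 ≤ C₁) (l : Fin L) {ι : Type*} [Fintype ι]
    (q : OrthonormalBasis ι ℝ (EuclideanSpace ℝ (Fin (w l)))) :
    ∑ i, ‖(-lam) • op (θ l) (q i)
        + ((Astar p.1 p.2 - netMatrix θ p.1 p.2) * ⟪f l, q i⟫) • b (l + 1)‖ ^ 2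
      ≤ 2 * (gradBound L C₁ C + lam ^ 2 * C) := by
  set ρ := Astar p.1 p.2 - netMatrix θ p.1 p.2 with hρ
  have h1 := h.gradient_sq_le hC hK hA l.2
  rw [← hρ] at h1
  simp_rw [← op_add_vecMulVec]
  rw [← frobSq_eq_sum, frobSq_add_vecMulVec]
  set B := ⟪b (l + 1), op (θ l) (f l)⟫
  have hB : B ^ 2 ≤ ‖b (l + 1)‖ ^ 2 * (frobSq (θ l) * ‖f l‖ ^ 2) := by
    have e1 := abs_real_inner_le_norm (b (l + 1)) (op (θ l) (f l))
    calc B ^ 2 = |B| ^ 2 := (sq_abs _).symm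
      _ ≤ (‖b (l + 1)‖ * ‖op (θ l) (f l)‖) ^ 2 := by gcongr
      _ ≤ _ := by rw [mul_pow]; gcongr; exact norm_op_sq_le _ _
  have hF := frobSq_nonneg (θ l)
  set X := ρ ^ 2 * (‖b (l + 1)‖ ^ 2 * ‖f l‖ ^ 2)
  have hX : 0 ≤ X := by positivity
  have h3 : 2 * (-lam) * ρ * B ≤ lam ^ 2 * frobSq (θ l) + X := by
    refine (abs_le_of_sq_le_sq' ?_ (by positivity)).2
    have e : (lam ^ 2 * ρ ^ 2) * B ^ 2
        ≤ (lam ^ 2 * ρ ^ 2) * (‖b (l + 1)‖ ^ 2 * (frobSq (θ l) * ‖f l‖ ^ 2)) := by gcongr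
    have e' : (lam ^ 2 * ρ ^ 2) * (‖b (l + 1)‖ ^ 2 * (frobSq (θ l) * ‖f l‖ ^ 2))
        = (lam ^ 2 * frobSq (θ l)) * X := by ring
    nlinarith [sq_nonneg (lam ^ 2 * frobSq (θ l) - X)]
  have h4 : lam ^ 2 * frobSq (θ l) ≤ lam ^ 2 * C := by gcongr; exact hK l
  nlinarith

/-- One step changes the approximate rank by at most a drift that is negative away from the
integers, up to errors from the imperfect balance and from the discretization. -/
lemma approxRank_sgdStep_le {α ε : ℝ} (hL : 3 ≤ L) (hα : 0 < α) (hη : 0 ≤ η) (hlam : 0 ≤ lam)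
    (hC : 0 ≤ C) (hε : 0 ≤ ε) (hK : ∀ l, frobSq (θ l) ≤ C) (hbal : IsBalanced θ ε)
    (hA : Astar p.1 p.2 ^ 2 ≤ C₁)
    (hQα : √(2 * (C₁ + C ^ L)) * √α ^ (L - 2) ≤ lam) (l : Fin L) :
    ∃ F : Fin (w l) → ℝ, (∀ i, 0 ≤ F i) ∧ (∀ i, F i ≤ 1) ∧
      approxRank α ((θ l).transpose * θ l) = ∑ i, F i ∧
      approxRank α ((sgdStep Astar lam η p θ l).transpose * sgdStep Astar lam η p θ l)
        ≤ ∑ i, F i - η * lam / 3 * ∑ i, min (F i) (1 - F i)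
          + w l * (4 * η / α * √(2 * (C₁ + C ^ L)) * (L * √C ^ (L - 1) * √ε))
          + 4 * η ^ 2 / α * (gradBound L C₁ C + lam ^ 2 * C) := by
  obtain ⟨f, b, h⟩ := exists_isPath θ p
  obtain ⟨q, hq⟩ := exists_gram_eigenbasis (θ l)
  set s : Fin (w l) → ℝ := fun i =>
    (Matrix.toEuclideanLin ((θ l).transpose * θ l)).singularValues i with hsdef
  have hs : ∀ i, 0 ≤ s i := fun i => LinearMap.singularValues_nonneg _ _
  refine ⟨fun i => fAlpha α (s i), fun i => fAlpha_nonneg hα (hs i), fun i => fAlpha_le_one hα _,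
    rfl, ?_⟩
  set ρ := Astar p.1 p.2 - netMatrix θ p.1 p.2 with hρ
  set Q := √(2 * (C₁ + C ^ L)) with hQ
  have hρQ : |ρ| ≤ Q := Real.abs_le_sqrt (residual_sq_le hC hK hA)
  set E := L * √C ^ (L - 1) * √ε with hE
  have hE0 : 0 ≤ E := by positivity
  set d : Fin (w l) → EuclideanSpace ℝ (Fin (w (l + 1))) := fun i =>
    (-lam) • op (θ l) (q i) + (ρ * ⟪f l, q i⟫) • b (l + 1) with hd
  have hsum : ∑ i, ‖d i‖ ^ 2 ≤ 2 * (gradBound L C₁ C + lam ^ 2 * C) :=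
    sum_norm_increment_sq_le h hC hK hA l q
  have hnorm : ∀ i, ‖op (θ l) (q i)‖ ^ 2 = s i := fun i => by
    rw [← real_inner_self_eq_norm_sq, ← inner_op_gram, hq, real_inner_smul_right,
      real_inner_self_eq_norm_sq, q.norm_eq_one]
    ring
  have hterm : ∀ i, fAlpha α (‖op (sgdStep Astar lam η p θ l) (q i)‖ ^ 2)
      ≤ fAlpha α (s i) - η * lam / 3 * min (fAlpha α (s i)) (1 - fAlpha α (s i))
        + 4 * η / α * Q * E + 2 / α * η ^ 2 * ‖d i‖ ^ 2 := fun i => by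
    have e1 : op (sgdStep Astar lam η p θ l) (q i) = op (θ l) (q i) + η • d i := by
      rw [h.sgdStep_eq, op_add_vecMulVec, hd]; module
    have e2 : ‖op (sgdStep Astar lam η p θ l) (q i)‖ ^ 2
        = s i + 2 * η * (ρ * ⟪f l, q i⟫ * ⟪b (l + 1), op (θ l) (q i)⟫ - lam * s i)
          + η ^ 2 * ‖d i‖ ^ 2 := by
      have e3 : ⟪op (θ l) (q i), d i⟫
          = ρ * ⟪f l, q i⟫ * ⟪b (l + 1), op (θ l) (q i)⟫ - lam * s i := by
        rw [hd, inner_add_right, real_inner_smul_right, real_inner_smul_right,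
          real_inner_self_eq_norm_sq, hnorm, real_inner_comm (b (l + 1))]
        ring
      rw [e1, norm_add_sq_real, real_inner_smul_right, e3, hnorm, norm_smul, mul_pow,
        Real.norm_eq_abs, sq_abs]
      ring
    have e4 : ρ * ⟪f l, q i⟫ * ⟪b (l + 1), op (θ l) (q i)⟫ ≤ Q * (√(s i) ^ L + E) := by
      have e5 := h.abs_inner_mul_le hC hK hε hbal l (q.norm_eq_one i) (hs i) (hq i)
      calc ρ * ⟪f l, q i⟫ * ⟪b (l + 1), op (θ l) (q i)⟫
          ≤ |ρ * ⟪f l, q i⟫ * ⟪b (l + 1), op (θ l) (q i)⟫| := le_abs_self _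
        _ = |ρ| * (|⟪b (l + 1), op (θ l) (q i)⟫| * |⟪f l, q i⟫|) := by
          rw [abs_mul, abs_mul]; ring
        _ ≤ _ := by gcongr
    have hF0 := fAlphaDeriv_nonneg (α := α) (s i)
    have hF1 := fAlphaDeriv_le hα (hs i)
    have e6 := fAlphaDeriv_drift hL hα (hs i) hlam (Real.sqrt_nonneg _) hQα
    have e7 := mul_le_mul_of_nonneg_left e6 (by positivity : 0 ≤ 2 * η)
    refine (fAlpha_le_tangent hα (s i) _).trans ?_
    rw [e2]
    have e8 : fAlphaDeriv α (s i) * (Q * E) ≤ 2 / α * (Q * E) := by gcongr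
    have e9 : fAlphaDeriv α (s i) * (η ^ 2 * ‖d i‖ ^ 2) ≤ 2 / α * (η ^ 2 * ‖d i‖ ^ 2) := by gcongr
    have e10 := mul_le_mul_of_nonneg_left e8 (by positivity : 0 ≤ 2 * η)
    have e11 := mul_le_mul_of_nonneg_left e4 (mul_nonneg (by positivity : 0 ≤ 2 * η) hF0)
    have e12 : 4 * η / α * Q * E = 2 * η * (2 / α * (Q * E)) := by ring
    rw [e12]
    linarith
  refine (approxRank_le_sum hα _ q).trans ((Finset.sum_le_sum fun i _ => hterm i).trans ?_)
  rw [Finset.sum_add_distrib, Finset.sum_add_distrib, Finset.sum_sub_distrib, Finset.sum_const,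
    Finset.card_univ, Fintype.card_fin, nsmul_eq_mul, ← Finset.mul_sum, ← Finset.mul_sum]
  beta_reduce
  have e13 : 2 / α * η ^ 2 * ∑ i, ‖d i‖ ^ 2
      ≤ 2 / α * η ^ 2 * (2 * (gradBound L C₁ C + lam ^ 2 * C)) := by gcongr
  have e14 : 2 / α * η ^ 2 * (2 * (gradBound L C₁ C + lam ^ 2 * C))
      = 4 * η ^ 2 / α * (gradBound L C₁ C + lam ^ 2 * C) := by ring
  rw [e14] at e13
  linarith

end ApproxRank

/-! ### Closedness of `B_r` -/

lemma width_le_maxWidth {L : ℕ} (w : ℕ → ℕ) {k : ℕ} (hk : k ≤ L) : w k ≤ maxWidth L w :=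
  Finset.le_sup (f := w) (Finset.mem_range.2 (Nat.lt_succ_of_le hk))

/-- The bound on `α` in a form without real exponents. -/
lemma sqrt_mul_sqrt_pow_le {L : ℕ} {α lam A : ℝ} (hL : 3 ≤ L) (hα : 0 < α) (hlam : 0 < lam)
    (hA : 0 < A) (h : α ≤ (lam ^ 2 / A) ^ (1 / ((L : ℝ) - 2))) : √A * √α ^ (L - 2) ≤ lam := by
  obtain ⟨k, rfl⟩ : ∃ k, L = k + 3 := ⟨L - 3, by omega⟩
  have hX : 0 ≤ lam ^ 2 / A := by positivity
  have e1 : α ^ (k + 1) ≤ lam ^ 2 / A := by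
    calc α ^ (k + 1) ≤ ((lam ^ 2 / A) ^ (1 / (((k + 3 : ℕ) : ℝ) - 2))) ^ (k + 1) := by gcongr
      _ = lam ^ 2 / A := by
        rw [← Real.rpow_natCast, ← Real.rpow_mul hX]
        have : 1 / (((k + 3 : ℕ) : ℝ) - 2) * ((k + 1 : ℕ) : ℝ) = 1 := by
          push_cast
          have : (k : ℝ) + 3 - 2 = k + 1 := by ring
          rw [this]; field_simp
        rw [this, Real.rpow_one]
  refine le_of_sq_le_sq ?_ hlam.le
  have e2 : k + 3 - 2 = k + 1 := by omega
  rw [e2, mul_pow, Real.sq_sqrt hA.le, ← pow_mul, mul_comm (k + 1), pow_mul, Real.sq_sqrt hα.le]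
  calc A * α ^ (k + 1) ≤ A * (lam ^ 2 / A) := by gcongr
    _ = lam ^ 2 := by field_simp

lemma rpow_half_eq_sqrt_pow {L : ℕ} {C : ℝ} (hL : 1 ≤ L) (hC : 0 ≤ C) :
    C ^ (((L : ℝ) - 1) / 2) = √C ^ (L - 1) := by
  rw [Real.sqrt_eq_rpow, ← Real.rpow_natCast, ← Real.rpow_mul hC, Nat.cast_sub hL]
  congr 1
  push_cast; ring

section Closed

variable {L : ℕ} {w : ℕ → ℕ} {θ : Params L w} {p : Fin (w L) × Fin (w 0)}
  {C C₁ lam η α ε₁ ε₂ : ℝ} {r : ℕ} {Astar : Matrix (Fin (w L)) (Fin (w 0)) ℝ}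

lemma sgdStep_mem_setB (hL : 3 ≤ L) (hC₁ : 0 < C₁) (hlam : 0 < lam) (hα : 0 < α)
    (hε₁ : 0 < ε₁) (hε₂ : 0 < ε₂) (hη : 0 < η) (hA : Astar p.1 p.2 ^ 2 ≤ C₁)
    (hC : C₁ / (2 * lam) ≤ C)
    (hαle : α ≤ (lam ^ 2 / (2 * (C₁ + C ^ L))) ^ (1 / ((L : ℝ) - 2)))
    (hε₂lt : ε₂ < 1 / 2)
    (hε₁le : √ε₁ ≤ lam * α * ε₂ / (32 * (maxWidth L w : ℝ) * L * (r + 1)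
      * C ^ (((L : ℝ) - 1) / 2) * √(2 * (C₁ + C ^ L))))
    (hη₁ : η ≤ C₁ / (4 * (gradBound L C₁ C + lam ^ 2 * C)))
    (hη₂ : η ≤ 2 * lam * ε₁ / (4 * (C₁ + C ^ L) * C ^ (L - 1) + lam ^ 2 * ε₁))
    (hη₃ : η ≤ lam * α * ε₂ / (32 * (maxWidth L w : ℝ) * (r + 1)
      * (gradBound L C₁ C + lam ^ 2 * C)))
    (hθ : θ ∈ setB L w r C α ε₁ ε₂) :
    sgdStep Astar lam η p θ ∈ setB L w r C α ε₁ ε₂ := by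
  obtain ⟨⟨hK, hbal⟩, hrank⟩ := hθ
  have hC0 : 0 < C := lt_of_lt_of_le (by positivity) hC
  have hC1lam : C₁ ≤ 2 * lam * C := by rw [div_le_iff₀ (by positivity)] at hC; linarith
  set X := gradBound L C₁ C with hX
  have hX0 : 0 < X := by rw [hX, gradBound]; positivity
  have hη₁' : η * X + η * lam ^ 2 * C ≤ C₁ / 4 := by
    rw [le_div_iff₀ (by positivity)] at hη₁; nlinarith
  have hx : η * lam ≤ 1 / 2 := by
    have h1 : 0 < η * X := by positivity
    have h2 : η * lam * (lam * C) ≤ 1 / 2 * (lam * C) := by nlinarith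
    exact le_of_mul_le_mul_right h2 (by positivity)
  have hx0 : 0 < η * lam := by positivity
  have hX2 : 4 * (C₁ + C ^ L) * C ^ (L - 1) = 2 * X := by rw [hX, gradBound]; ring
  refine ⟨⟨fun l => ?_, ?_⟩, fun l => ?_⟩
  · refine (frobSq_sgdStep_le hη.le (by linarith) hC0.le hK hA l).trans ?_
    rw [← hX]
    have e1 : η * (η * X + η * lam ^ 2 * C) ≤ η * (C₁ / 4) := by gcongr
    have e2 : η * C₁ ≤ η * (2 * lam * C) := by gcongr
    have e3 : 0 ≤ η * lam * (η * C₁) := by positivity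
    nlinarith
  · refine (IsBalanced.sgdStep hbal hC₁.le hε₁.le hC0.le hK hA).mono ?_
    rw [← hX]
    rw [hX2, le_div_iff₀ (by positivity)] at hη₂
    have e1 := mul_le_mul_of_nonneg_left hη₂ hη.le
    nlinarith [mul_pos (mul_pos hη hη) hX0]
  · have hw : 0 < w L := Fin.pos p.1
    have hn : 0 < (maxWidth L w : ℝ) := by
      exact_mod_cast hw.trans_le (width_le_maxWidth w le_rfl)
    have hwl : (w l : ℝ) ≤ maxWidth L w := by exact_mod_cast width_le_maxWidth w l.2.le
    have hn1 : (1 : ℝ) ≤ maxWidth L w := by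
      exact_mod_cast hw.trans_le (width_le_maxWidth w le_rfl)
    have hA0 : 0 < 2 * (C₁ + C ^ L) := by positivity
    set Q := √(2 * (C₁ + C ^ L)) with hQ
    have hQ0 : 0 < Q := Real.sqrt_pos.2 hA0
    have hCs : 0 < √C ^ (L - 1) := pow_pos (Real.sqrt_pos.2 hC0) _
    have hL0 : (0 : ℝ) < L := by exact_mod_cast (by omega : 0 < L)
    obtain ⟨F, hF0, hF1, hF, hstep⟩ := approxRank_sgdStep_le (Astar := Astar) (p := p) (η := η)
      hL hα hη.le hlam.le hC0.le hε₁.le hK hbal hA (sqrt_mul_sqrt_pow_le hL hα hlam hA0 hαle) l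
    rw [← hQ, ← hX] at hstep
    refine hstep.trans ?_
    rw [rpow_half_eq_sqrt_pow (by omega) hC0.le, le_div_iff₀ (by positivity)] at hε₁le
    rw [le_div_iff₀ (by positivity)] at hη₃
    have hr1 : (1 : ℝ) ≤ r + 1 := by linarith [Nat.cast_nonneg (α := ℝ) r]
    have herr₁ : w l * (4 * η / α * Q * (L * √C ^ (L - 1) * √ε₁)) ≤ η * lam * ε₂ / 8 := by
      have hT : 0 ≤ √ε₁ * (maxWidth L w * L * √C ^ (L - 1) * Q) := by positivity
      calc w l * (4 * η / α * Q * (L * √C ^ (L - 1) * √ε₁))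
          ≤ maxWidth L w * (4 * η / α * Q * (L * √C ^ (L - 1) * √ε₁)) := by gcongr
        _ = η / (8 * α) * (32 * (√ε₁ * (maxWidth L w * L * √C ^ (L - 1) * Q)) * 1) := by
          field_simp; ring
        _ ≤ η / (8 * α) * (32 * (√ε₁ * (maxWidth L w * L * √C ^ (L - 1) * Q)) * (r + 1)) := by
          gcongr
        _ ≤ η / (8 * α) * (lam * α * ε₂) :=
          mul_le_mul_of_nonneg_left (by linarith) (by positivity)
        _ = _ := by field_simp
    have herr₂ : 4 * η ^ 2 / α * (X + lam ^ 2 * C) ≤ η * lam * ε₂ / 8 := by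
      have hY : 0 ≤ X + lam ^ 2 * C := by positivity
      have hnr : 1 ≤ (maxWidth L w : ℝ) * (r + 1) := by nlinarith
      calc 4 * η ^ 2 / α * (X + lam ^ 2 * C)
          = η / (8 * α) * (32 * η * (X + lam ^ 2 * C) * 1) := by field_simp; ring
        _ ≤ η / (8 * α) * (32 * η * (X + lam ^ 2 * C) * (maxWidth L w * (r + 1))) := by gcongr
        _ ≤ η / (8 * α) * (lam * α * ε₂) :=
          mul_le_mul_of_nonneg_left (by linarith) (by positivity)
        _ = _ := by field_simp
    have hle := hrank l
    rw [hF] at hle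
    -- near the upper bound the drift beats the errors, elsewhere the errors cannot reach it
    rcases le_total (r + 3 / 4 * ε₂) (∑ i, F i) with hcase | hcase
    · have hmin := le_sum_min hF0 hF1 hcase (by linarith)
      have := mul_le_mul_of_nonneg_left hmin (by positivity : 0 ≤ η * lam / 3)
      linarith
    · have hmin : 0 ≤ ∑ i, min (F i) (1 - F i) :=
        Finset.sum_nonneg fun i _ => le_min (hF0 i) (sub_nonneg.2 (hF1 i))
      have := mul_nonneg (by positivity : 0 ≤ η * lam / 3) hmin
      have := mul_le_mul_of_nonneg_right hx hε₂.le
      linarith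

end Closed

/-! ### Burn-in: bounded and balanced iterates -/

lemma frobSq_le_maxFrobSq {L : ℕ} {w : ℕ → ℕ} (θ : Params L w) (l : Fin L) :
    frobSq (θ l) ≤ maxFrobSq θ :=
  le_ciSup (f := fun l => frobSq (θ l)) (Set.finite_range _).bddAbove l

lemma sgd_add {L : ℕ} {w : ℕ → ℕ} (Astar : Matrix (Fin (w L)) (Fin (w 0)) ℝ) (lam η : ℝ)
    (idx : ℕ → Fin (w L) × Fin (w 0)) (θ₀ : Params L w) (s t : ℕ) :
    sgd Astar lam η idx θ₀ (s + t)
      = sgd Astar lam η (fun u => idx (s + u)) (sgd Astar lam η idx θ₀ s) t := by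
  induction t with
  | zero => rfl
  | succ t ih => rw [← add_assoc, sgd, ih, sgd]

/-- The step size condition under which the parameters with `‖W_l‖_F² ≤ C`, and the
`ε₁`-balanced ones among them, are absorbing. -/
structure SmallStep (L : ℕ) (C₁ C ε₁ lam η : ℝ) : Prop where
  C₁_pos : 0 < C₁
  lam_pos : 0 < lam
  ε₁_pos : 0 < ε₁
  η_pos : 0 < η
  C₁_le : C₁ ≤ lam * C
  ε₁_le : ε₁ ≤ C
  η_le : η * (2 * gradBound L C₁ C + 2 * lam ^ 2 * C) ≤ lam * ε₁

namespace SmallStep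

variable {L : ℕ} {w : ℕ → ℕ} {C₁ C ε₁ lam η : ℝ}

lemma C_pos (h : SmallStep L C₁ C ε₁ lam η) : 0 < C := h.ε₁_pos.trans_le h.ε₁_le

lemma decay_pos (h : SmallStep L C₁ C ε₁ lam η) : 0 < η * lam := mul_pos h.η_pos h.lam_pos

lemma decay_le (h : SmallStep L C₁ C ε₁ lam η) : η * lam ≤ 1 / 2 := by
  have h1 := gradBound_nonneg (L := L) h.C₁_pos.le h.C_pos.le
  have h2 := h.η_le
  have h3 : η * lam * (lam * C) ≤ 1 / 2 * (lam * C) := by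
    nlinarith [mul_nonneg h.η_pos.le h1, mul_le_mul_of_nonneg_left h.ε₁_le h.lam_pos.le]
  exact le_of_mul_le_mul_right h3 (mul_pos h.lam_pos h.C_pos)

/-- The second order error of a step from parameters with `‖W_l‖_F² ≤ C`. -/
lemma sq_mul_gradBound_le (h : SmallStep L C₁ C ε₁ lam η) :
    η ^ 2 * gradBound L C₁ C ≤ η * lam * ε₁ / 2 - (η * lam) ^ 2 * C := by
  have := mul_le_mul_of_nonneg_left h.η_le h.η_pos.le
  nlinarith

variable {θ : Params L w} {p : Fin (w L) × Fin (w 0)} {Astar : Matrix (Fin (w L)) (Fin (w 0)) ℝ}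

lemma frobSq_step_le (h : SmallStep L C₁ C ε₁ lam η) (hA : Astar p.1 p.2 ^ 2 ≤ C₁)
    (hK : ∀ l, frobSq (θ l) ≤ C) (l : Fin L) : frobSq (sgdStep Astar lam η p θ l) ≤ C := by
  have hx := h.decay_le
  have hx0 := h.decay_pos
  refine (frobSq_sgdStep_le h.η_pos.le (by linarith) h.C_pos.le hK hA l).trans ?_
  have h1 := h.sq_mul_gradBound_le
  have h2 := mul_le_mul_of_nonneg_left h.ε₁_le hx0.le
  have h3 := mul_le_mul_of_nonneg_left h.C₁_le
    (mul_nonneg (by linarith : 0 ≤ 1 - η * lam) h.η_pos.le)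
  have h4 : 0 ≤ (η * lam) ^ 2 * C := mul_nonneg (sq_nonneg _) h.C_pos.le
  nlinarith

/-- Up to the floor `ε₁ / 4`, the balance defect contracts. -/
lemma isBalanced_step (h : SmallStep L C₁ C ε₁ lam η) (hA : Astar p.1 p.2 ^ 2 ≤ C₁)
    (hK : ∀ l, frobSq (θ l) ≤ C) {D : ℝ} (hD : 0 ≤ D) (hbal : IsBalanced θ (ε₁ / 4 + D)) :
    IsBalanced (sgdStep Astar lam η p θ) (ε₁ / 4 + (1 - η * lam) ^ 2 * D) := by
  have hx := h.decay_le
  have hx0 := h.decay_pos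
  have hε := h.ε₁_pos
  refine (hbal.sgdStep h.C₁_pos.le (by positivity) h.C_pos.le hK hA).mono ?_
  have h1 := h.sq_mul_gradBound_le
  have h2 := mul_le_mul_of_nonneg_left h.ε₁_le (sq_nonneg (η * lam))
  have h3 : 0 ≤ (η * lam) ^ 2 * ε₁ := by positivity
  nlinarith

lemma step_mem_boundedBalanced (h : SmallStep L C₁ C ε₁ lam η) (hA : Astar p.1 p.2 ^ 2 ≤ C₁)
    (hθ : θ ∈ boundedBalanced L w C ε₁) :
    sgdStep Astar lam η p θ ∈ boundedBalanced L w C ε₁ := by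
  have hx := h.decay_le
  have hx0 := h.decay_pos
  have hε := h.ε₁_pos
  obtain ⟨hK, hbal⟩ := hθ
  refine ⟨h.frobSq_step_le hA hK, (h.isBalanced_step hA hK (D := 3 / 4 * ε₁) (by positivity)
    (IsBalanced.mono hbal (by linarith))).mono ?_⟩
  have : (1 - η * lam) ^ 2 ≤ 1 := by nlinarith
  nlinarith

section Iterates

variable {idx : ℕ → Fin (w L) × Fin (w 0)} {θ₀ : Params L w}

lemma sgd_mem_boundedBalanced (h : SmallStep L C₁ C ε₁ lam η)
    (hidx : ∀ t, Astar (idx t).1 (idx t).2 ^ 2 ≤ C₁) (hθ : θ₀ ∈ boundedBalanced L w C ε₁)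
    (t : ℕ) : sgd Astar lam η idx θ₀ t ∈ boundedBalanced L w C ε₁ := by
  induction t with
  | zero => exact hθ
  | succ t ih => exact h.step_mem_boundedBalanced (hidx t) ih

lemma sgd_bounded_and_balanced (h : SmallStep L C₁ C ε₁ lam η)
    (hidx : ∀ t, Astar (idx t).1 (idx t).2 ^ 2 ≤ C₁) (hK : ∀ l, frobSq (θ₀ l) ≤ C) {D : ℝ}
    (hD : 0 ≤ D) (hbal : IsBalanced θ₀ (ε₁ / 4 + D)) (t : ℕ) :
    (∀ l, frobSq (sgd Astar lam η idx θ₀ t l) ≤ C) ∧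
      IsBalanced (sgd Astar lam η idx θ₀ t) (ε₁ / 4 + ((1 - η * lam) ^ 2) ^ t * D) := by
  induction t with
  | zero => simpa [sgd] using ⟨hK, hbal⟩
  | succ t ih =>
    refine ⟨h.frobSq_step_le (hidx t) ih.1, ?_⟩
    have := h.isBalanced_step (hidx t) ih.1 (by positivity) ih.2
    rwa [pow_succ', mul_assoc]

/-- One step from parameters with `‖W_l‖_F² ≤ κ ≤ C₀`, where `C₀` may exceed `C`. -/
lemma large_step {C₀ κ : ℝ} (h : SmallStep L C₁ C ε₁ lam η) (hA : Astar p.1 p.2 ^ 2 ≤ C₁)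
    (hη : η * (4 * (gradBound L C₁ C₀ + lam ^ 2 * C₀)) ≤ C₁) (hκ : 0 ≤ κ) (hκC : κ ≤ C₀)
    (hK : ∀ l, frobSq (θ l) ≤ κ) :
    (∀ l, frobSq (sgdStep Astar lam η p θ l) ≤ (1 - η * lam) ^ 2 * κ + 3 / 4 * (η * lam) * C) ∧
      IsBalanced (sgdStep Astar lam η p θ) ((1 - η * lam) ^ 2 * κ + η * lam * C / 4) := by
  have hx := h.decay_le
  have hx0 := h.decay_pos
  have hC₁ := h.C₁_pos
  have hη0 := h.η_pos
  have h1 := gradBound_mono (L := L) h.C₁_pos.le hκ hκC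
  have h2 : η * gradBound L C₁ κ ≤ C₁ / 4 := by
    have h3 := mul_le_mul_of_nonneg_left h1 hη0.le
    have h4 : 0 ≤ η * (lam ^ 2 * C₀) := by have := hκ.trans hκC; positivity
    linarith
  have h5 : η ^ 2 * gradBound L C₁ κ ≤ η * lam * C / 4 := by
    have h6 := mul_le_mul_of_nonneg_left h2 hη0.le
    have h7 := mul_le_mul_of_nonneg_left h.C₁_le hη0.le
    nlinarith
  refine ⟨fun l => (frobSq_sgdStep_le hη0.le (by linarith) hκ hK hA l).trans ?_,
    ((isBalanced_of_frobSq_le hκ hK).sgdStep hC₁.le hκ hκ hK hA).mono (by linarith)⟩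
  have h8 : 0 ≤ η * lam * (η * C₁) := by positivity
  have h9 := mul_le_mul_of_nonneg_left h.C₁_le hη0.le
  nlinarith

/-- For `C ≤ C₀`, the squared norms decay geometrically from `C₀` to `C / 2`. -/
lemma frobSq_sgd_le {C₀ : ℝ} (h : SmallStep L C₁ C ε₁ lam η)
    (hidx : ∀ t, Astar (idx t).1 (idx t).2 ^ 2 ≤ C₁)
    (hη : η * (4 * (gradBound L C₁ C₀ + lam ^ 2 * C₀)) ≤ C₁) (hC₀ : C ≤ C₀)
    (hK : ∀ l, frobSq (θ₀ l) ≤ C₀) (t : ℕ) (l : Fin L) :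
    frobSq (sgd Astar lam η idx θ₀ t l) ≤ min C₀ (C / 2 + ((1 - η * lam) ^ 2) ^ t * C₀) := by
  have hx := h.decay_le
  have hx0 := h.decay_pos
  have hC := h.C_pos
  have hC₀' : 0 < C₀ := hC.trans_le hC₀
  have ha : 3 / 4 * (η * lam) * C ≤ (1 - (1 - η * lam) ^ 2) * (C / 2) := by
    have : 0 ≤ (η * lam) * (1 / 2 - η * lam) * C :=
      mul_nonneg (mul_nonneg hx0.le (by linarith)) hC.le
    nlinarith
  have ha1 : (1 - η * lam) ^ 2 ≤ 1 := by nlinarith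
  induction t generalizing l with
  | zero => refine (hK l).trans (le_min le_rfl ?_); simp; positivity
  | succ t ih =>
    have h1 := (h.large_step (hidx t) hη (by positivity) (min_le_left _ _) ih).1 l
    refine h1.trans (le_min ?_ ?_)
    · have := mul_le_mul_of_nonneg_left (min_le_left C₀ (C / 2 + ((1 - η * lam) ^ 2) ^ t * C₀))
        (sq_nonneg (1 - η * lam))
      have := mul_le_mul_of_nonneg_left hC₀ (sub_nonneg.2 ha1)
      nlinarith
    · have := mul_le_mul_of_nonneg_left (min_le_right C₀ (C / 2 + ((1 - η * lam) ^ 2) ^ t * C₀))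
        (sq_nonneg (1 - η * lam))
      rw [pow_succ' ((1 - η * lam) ^ 2) t]
      linarith

/-- After the burn-in time `T₀`, the iterates are bounded and balanced. While the squared norms may
exceed `C`, they are the only bound used for the balance defects; these contract from the time on
at which the squared norms have come down to `C`. -/
lemma burn_in {C₀ : ℝ} {T₀ : ℕ} (h : SmallStep L C₁ C ε₁ lam η)
    (hidx : ∀ t, Astar (idx t).1 (idx t).2 ^ 2 ≤ C₁)
    (hη : η * (4 * (gradBound L C₁ C₀ + lam ^ 2 * C₀)) ≤ C₁) (hC₀ : 0 ≤ C₀)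
    (hK : ∀ l, frobSq (θ₀ l) ≤ C₀) (hT₀ : Real.log (2 * C₀ / ε₁) / (η * lam) ≤ T₀) :
    sgd Astar lam η idx θ₀ T₀ ∈ boundedBalanced L w C ε₁ := by
  have hx := h.decay_le
  have hx0 := h.decay_pos
  have hC := h.C_pos
  have hε := h.ε₁_pos
  have hεC := h.ε₁_le
  set a := (1 - η * lam) ^ 2 with ha
  have ha0 : 0 < a := pow_pos (by linarith) 2
  have ha1 : a ≤ 1 := by rw [ha]; nlinarith
  have hdecay : a ^ T₀ * C₀ * (4 * C₀) ≤ ε₁ ^ 2 := by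
    rcases hC₀.eq_or_lt with h0 | h0
    · rw [← h0]; simp; positivity
    · rw [div_le_iff₀ hx0] at hT₀
      have e1 : (1 - η * lam) ^ T₀ ≤ Real.exp (-(T₀ * (η * lam))) := by
        rw [← mul_neg, Real.exp_nat_mul]
        have := Real.add_one_le_exp (-(η * lam))
        gcongr
        · linarith
        · linarith
      have e2 : Real.exp (-(T₀ * (η * lam))) ≤ (2 * C₀ / ε₁)⁻¹ := by
        rw [Real.exp_neg]
        gcongr
        exact (Real.le_exp_log _).trans (Real.exp_le_exp.2 hT₀)
      have e3 : (1 - η * lam) ^ T₀ * (2 * C₀) ≤ ε₁ := by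
        have e4 := mul_le_mul_of_nonneg_right (e1.trans e2) (by positivity : 0 ≤ 2 * C₀)
        rwa [inv_div, div_mul_cancel₀ _ (by positivity)] at e4
      have e5 : 0 ≤ (1 - η * lam) ^ T₀ * (2 * C₀) :=
        mul_nonneg (pow_nonneg (by linarith) _) (by positivity)
      calc a ^ T₀ * C₀ * (4 * C₀) = ((1 - η * lam) ^ T₀ * (2 * C₀)) ^ 2 := by
            rw [ha, ← pow_mul, mul_comm 2, pow_mul]; ring
        _ ≤ ε₁ ^ 2 := by gcongr
  rcases lt_or_ge C₀ C with hcase | hcase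
  · -- here `‖W_l‖_F² ≤ C` holds from the start
    have hK' : ∀ l, frobSq (θ₀ l) ≤ C := fun l => (hK l).trans hcase.le
    obtain ⟨g1, g2⟩ := h.sgd_bounded_and_balanced hidx hK' hC₀
      ((isBalanced_of_frobSq_le hC₀ hK).mono (by linarith)) T₀
    refine ⟨g1, g2.mono ?_⟩
    rw [← ha]
    have e1 : a ^ T₀ ≤ 1 := pow_le_one₀ ha0.le ha1
    have e2 : 0 ≤ a ^ T₀ * C₀ := by positivity
    rcases le_total (2 * C₀) ε₁ with e3 | e3
    · have : a ^ T₀ * C₀ ≤ 1 * C₀ := by gcongr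
      linarith
    · have : a ^ T₀ * C₀ * (2 * ε₁) ≤ ε₁ / 2 * (2 * ε₁) := by nlinarith
      have := le_of_mul_le_mul_right this (by positivity)
      linarith
  · have hC₀' : 0 < C₀ := hC.trans_le hcase
    have hend : a ^ T₀ * C₀ ≤ ε₁ / 4 := by
      have e1 : a ^ T₀ * C₀ * (4 * C₀) ≤ ε₁ / 4 * (4 * C₀) := by nlinarith
      exact le_of_mul_le_mul_right e1 (by positivity)
    have hex : ∃ t, a ^ t * C₀ ≤ C / 2 := ⟨T₀, by linarith⟩
    classical
    obtain ⟨t₁, ht₁⟩ : ∃ t₁, Nat.find hex = t₁ + 1 := by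
      refine Nat.exists_eq_succ_of_ne_zero fun h0 => ?_
      have := (Nat.find_eq_zero hex).1 h0
      rw [pow_zero, one_mul] at this
      linarith
    have hlt : C / 2 < a ^ t₁ * C₀ := not_le.1 (Nat.find_min hex (by omega))
    have hle : a ^ (t₁ + 1) * C₀ ≤ C / 2 := ht₁ ▸ Nat.find_spec hex
    have hT : t₁ + 1 ≤ T₀ := by
      rw [← ht₁]; exact Nat.find_min' hex (by linarith)
    obtain ⟨s, rfl⟩ := Nat.exists_eq_add_of_le hT
    have hnorm := h.frobSq_sgd_le hidx hη hcase hK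
    have hK₁ : ∀ l, frobSq (sgd Astar lam η idx θ₀ (t₁ + 1) l) ≤ C := fun l =>
      (hnorm (t₁ + 1) l).trans ((min_le_right _ _).trans (by linarith))
    set κ := a ^ t₁ * C₀ with hκ
    have hbal₁ : IsBalanced (sgd Astar lam η idx θ₀ (t₁ + 1)) (ε₁ / 4 + 3 * (a * κ)) := by
      refine (h.large_step (hidx t₁) hη (by positivity) (min_le_left _ _) (hnorm t₁)).2.mono ?_
      have e1 := mul_le_mul_of_nonneg_left (min_le_right C₀ (C / 2 + κ)) ha0.le
      have e2 : a * (C / 2) ≤ a * κ := by gcongr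
      have e3 : η * lam / 2 ≤ a := by rw [ha]; nlinarith
      have e4 : η * lam / 2 * (C / 2) ≤ a * κ := by gcongr
      linarith
    obtain ⟨g1, g2⟩ := h.sgd_bounded_and_balanced (idx := fun u => idx (t₁ + 1 + u))
      (fun t => hidx _) hK₁ (by positivity) hbal₁ s
    rw [sgd_add]
    refine ⟨g1, g2.mono ?_⟩
    rw [← ha]
    have e5 : a ^ s * (3 * (a * κ)) = 3 * (a ^ (t₁ + 1 + s) * C₀) := by rw [hκ]; ring
    rw [e5]
    linarith

end Iterates

end SmallStep

/-! ### From decaying rows or columns to small approximate rank -/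

lemma HasTail.of_columns {m n r : ℕ} (W : Matrix (Fin m) (Fin n) ℝ) {S : Finset (Fin n)}
    (hS : S.card = r) : HasTail r (∑ c ∈ Sᶜ, ∑ a, W a c ^ 2) W := by
  have hc : Sᶜ.card = n - r := by rw [Finset.card_compl, Fintype.card_fin, hS]
  refine ⟨fun i => EuclideanSpace.basisFun (Fin n) ℝ (Sᶜ.orderEmbOfFin hc i),
    (EuclideanSpace.basisFun (Fin n) ℝ).orthonormal.comp _ (Sᶜ.orderEmbOfFin hc).injective,
    le_of_eq ?_⟩
  simp_rw [norm_op_basisFun_sq]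
  refine Finset.sum_bij (fun i _ => Sᶜ.orderEmbOfFin hc i)
    (fun i _ => Finset.orderEmbOfFin_mem _ _ _)
    (fun i _ j _ hij => (Sᶜ.orderEmbOfFin hc).injective hij) (fun c hcS => ?_) (fun i _ => rfl)
  have : c ∈ Set.range (Sᶜ.orderEmbOfFin hc) := by
    rw [Finset.range_orderEmbOfFin]; exact hcS
  obtain ⟨i, hi⟩ := this
  exact ⟨i, Finset.mem_univ _, hi⟩

lemma sum_columns_le_frobSq {m n : ℕ} (W : Matrix (Fin m) (Fin n) ℝ) (S : Finset (Fin n)) :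
    ∑ c ∈ S, ∑ a, W a c ^ 2 ≤ frobSq W := by
  rw [← frobSq_transpose]
  exact Finset.sum_le_sum_of_subset_of_nonneg (Finset.subset_univ _)
    fun c _ _ => Finset.sum_nonneg fun a _ => sq_nonneg (W a c)

section Tail

variable {L : ℕ} {w : ℕ → ℕ} {θ : Params L w} {ε τ : ℝ} {r : ℕ}

lemma IsBalanced.quadratic (h : IsBalanced θ ε) {k : ℕ} (hk : k + 1 < L)
    (x : EuclideanSpace ℝ (Fin (w (k + 1)))) :
    |‖op (weight θ k).transpose x‖ ^ 2 - ‖op (weight θ (k + 1)) x‖ ^ 2| ≤ ε * ‖x‖ ^ 2 := by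
  rw [weight_of_lt θ (Nat.lt_of_succ_lt hk), weight_of_lt θ hk, ← inner_op_defect]
  exact (abs_inner_op_le_specNorm _ x).trans (mul_le_mul_of_nonneg_right (h k hk) (sq_nonneg _))

/-- A tail of one weight matrix gives a tail of every weight matrix. -/
lemma HasTail.all_layers (hbal : IsBalanced θ ε) (hε : 0 ≤ ε) {l : ℕ} (hl : l < L)
    (h : HasTail r τ (weight θ l)) {k : ℕ} (hk : k < L) :
    HasTail r (τ + (L - 1 : ℕ) * ((maxWidth L w - r : ℕ) * ε)) (weight θ k) := by
  set δ := ((maxWidth L w - r : ℕ) : ℝ) * ε with hδ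
  have hδ0 : 0 ≤ δ := by positivity
  have hwδ : ∀ k ≤ L, ((w k - r : ℕ) : ℝ) * ε ≤ δ := fun k hk => by
    have := width_le_maxWidth w hk
    rw [hδ]; gcongr
  have hdown : ∀ j k, k + j = l → HasTail r (τ + j * δ) (weight θ k) := by
    intro j
    induction j with
    | zero => rintro k rfl; simpa using h
    | succ j ih =>
      intro k hkj
      have h1 := (ih (k + 1) (by omega)).of_quadratic_le
        (W := (weight θ k).transpose) (ε := ε) fun x => by
          linarith [(abs_le.1 (hbal.quadratic (k := k) (by omega) x)).2]
      have h2 := h1.transpose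
      rw [Matrix.transpose_transpose] at h2
      refine h2.mono ?_
      have := hwδ (k + 1) (by omega)
      push_cast; linarith
  have hup : ∀ j, l + j < L → HasTail r (τ + j * δ) (weight θ (l + j)) := by
    intro j
    induction j with
    | zero => intro _; simpa using h
    | succ j ih =>
      intro hj
      have h1 := (ih (by omega)).transpose.of_quadratic_le
        (W := weight θ (l + j + 1)) (ε := ε) fun x => by
          linarith [(abs_le.1 (hbal.quadratic (k := l + j) (by omega) x)).1]
      refine h1.mono ?_
      have := hwδ (l + j + 1) (by omega)
      push_cast; linarith
  have hmono : ∀ j : ℕ, j ≤ L - 1 → τ + j * δ ≤ τ + (L - 1 : ℕ) * δ := fun j hj => by gcongr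
  rcases le_total k l with hkl | hkl
  · exact (hdown (l - k) k (by omega)).mono (hmono _ (by omega))
  · obtain ⟨j, rfl⟩ := Nat.exists_eq_add_of_le hkl
    exact (hup j hk).mono (hmono _ (by omega))

/-- If one weight matrix of bounded and balanced parameters has a tail as small as `τ`, then all
weight matrices have approximate rank at most `r`. -/
lemma mem_setB_of_hasTail {C α ε₂ : ℝ} (hα : 0 < α) (hε : 0 ≤ ε) (hε₂ : 0 ≤ ε₂) (hL : 1 ≤ L)
    (hr : r ≤ maxWidth L w)
    (hε₁ : 4 * ((maxWidth L w : ℝ) - r) * ((L : ℝ) - 1) * ε ≤ α * ε₂)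
    (hτ : r < maxWidth L w → τ * (4 * ((maxWidth L w : ℝ) - r)) ≤ α * ε₂) (hτ0 : 0 ≤ τ)
    (hθ : θ ∈ boundedBalanced L w C ε) {l : ℕ} (hl : l < L) (h : HasTail r τ (weight θ l)) :
    θ ∈ setB L w r C α ε ε₂ := by
  refine ⟨hθ, fun k => ?_⟩
  rcases hr.eq_or_lt with hrn | hrn
  · have h1 : approxRank α ((θ k).transpose * θ k) ≤ w k := by
      refine (Finset.sum_le_card_nsmul _ _ 1 fun i _ => fAlpha_le_one hα _).trans ?_
      simp
    have h2 : (w k : ℝ) ≤ r := by rw [hrn]; exact_mod_cast width_le_maxWidth w k.2.le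
    linarith
  · have h1 := HasTail.all_layers (θ := θ) hθ.2 hε hl h k.2
    rw [weight_of_lt θ k.2] at h1
    refine (h1.approxRank_le hα).trans ?_
    have h2 := hτ hrn
    have h3 : (1 : ℝ) ≤ (maxWidth L w : ℝ) - r := by
      have : (r : ℝ) + 1 ≤ maxWidth L w := by exact_mod_cast hrn
      linarith
    rw [Nat.cast_sub hL, Nat.cast_sub hr]
    have h4 : τ * 4 ≤ α * ε₂ := by nlinarith
    have h5 : τ + ((L : ℝ) - (1 : ℕ)) * (((maxWidth L w : ℝ) - r) * ε) ≤ α * ε₂ / 2 := by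
      push_cast; nlinarith
    calc (r : ℝ) + 2 / α * (τ + ((L : ℝ) - (1 : ℕ)) * (((maxWidth L w : ℝ) - r) * ε))
        ≤ r + 2 / α * (α * ε₂ / 2) := by gcongr
      _ = r + ε₂ := by field_simp

end Tail

section Decay

variable {w : ℕ → ℕ} {lam η : ℝ}

/-- Sampling only columns in `S`, the other columns of the first weight matrix feel only the
weight decay. -/
lemma sgd_first_apply {L : ℕ} (hL : 0 < L) (Astar : Matrix (Fin (w L)) (Fin (w 0)) ℝ)
    {idx : ℕ → Fin (w L) × Fin (w 0)} (θ₀ : Params L w) {S : Finset (Fin (w 0))} {T : ℕ}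
    (hidx : ∀ t < T, (idx t).2 ∈ S) {c : Fin (w 0)} (hc : c ∉ S) (a : Fin (w (0 + 1))) :
    sgd Astar lam η idx θ₀ T ⟨0, hL⟩ a c = (1 - η * lam) ^ T * θ₀ ⟨0, hL⟩ a c := by
  induction T with
  | zero => simp [sgd]
  | succ T ih =>
    obtain ⟨f, b, h⟩ := exists_isPath (sgd Astar lam η idx θ₀ T) (idx T)
    have hne : c ≠ (idx T).2 := fun e => hc (e ▸ hidx T (Nat.lt_succ_self T))
    have hf : f 0 c = 0 := by rw [h.f_zero]; simp [hne]
    rw [sgd, h.sgdStep_eq, Matrix.add_apply, Matrix.smul_apply, Matrix.smul_apply,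
      Matrix.vecMulVec_apply, ih fun t ht => hidx t (Nat.lt_succ_of_lt ht)]
    change _ + _ • (_ * f 0 c) = _
    rw [hf, pow_succ']
    simp [mul_assoc]

/-- Sampling only rows in `S`, the other rows of the last weight matrix feel only the weight
decay. -/
lemma sgd_last_apply {M : ℕ} (Astar : Matrix (Fin (w (M + 1))) (Fin (w 0)) ℝ)
    {idx : ℕ → Fin (w (M + 1)) × Fin (w 0)} (θ₀ : Params (M + 1) w)
    {S : Finset (Fin (w (M + 1)))} {T : ℕ} (hidx : ∀ t < T, (idx t).1 ∈ S)
    {a : Fin (w (M + 1))} (ha : a ∉ S) (c : Fin (w M)) :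
    sgd Astar lam η idx θ₀ T ⟨M, Nat.lt_succ_self M⟩ a c
      = (1 - η * lam) ^ T * θ₀ ⟨M, Nat.lt_succ_self M⟩ a c := by
  induction T with
  | zero => simp [sgd]
  | succ T ih =>
    obtain ⟨f, b, h⟩ := exists_isPath (sgd Astar lam η idx θ₀ T) (idx T)
    have hne : a ≠ (idx T).1 := fun e => ha (e ▸ hidx T (Nat.lt_succ_self T))
    have hb : b (M + 1) a = 0 := by rw [h.b_last]; simp [hne]
    rw [sgd, h.sgdStep_eq, Matrix.add_apply, Matrix.smul_apply, Matrix.smul_apply,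
      Matrix.vecMulVec_apply, ih fun t ht => hidx t (Nat.lt_succ_of_lt ht)]
    change _ + _ • (b (M + 1) a * _) = _
    rw [hb, pow_succ']
    simp [mul_assoc]

lemma hasTail_first {L : ℕ} (hL : 0 < L) (Astar : Matrix (Fin (w L)) (Fin (w 0)) ℝ)
    {idx : ℕ → Fin (w L) × Fin (w 0)} {θ₀ : Params L w} {S : Finset (Fin (w 0))} {T : ℕ} {C : ℝ}
    (hK : ∀ l, frobSq (θ₀ l) ≤ C) (hidx : ∀ t < T, (idx t).2 ∈ S) :
    HasTail S.card (((1 - η * lam) ^ 2) ^ T * C)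
      (weight (sgd Astar lam η idx θ₀ T) 0) := by
  rw [weight_of_lt _ hL]
  refine (HasTail.of_columns _ (S := S) rfl).mono ?_
  refine le_trans (le_of_eq ?_) (mul_le_mul_of_nonneg_left
    ((sum_columns_le_frobSq (θ₀ ⟨0, hL⟩) Sᶜ).trans (hK _)) (by positivity))
  rw [Finset.mul_sum]
  refine Finset.sum_congr rfl fun c hc => ?_
  rw [Finset.mul_sum]
  refine Finset.sum_congr rfl fun a _ => ?_
  rw [sgd_first_apply hL Astar θ₀ hidx (Finset.mem_compl.1 hc), mul_pow, ← pow_mul, ← pow_mul,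
    mul_comm 2]

lemma hasTail_last {M : ℕ} (Astar : Matrix (Fin (w (M + 1))) (Fin (w 0)) ℝ)
    {idx : ℕ → Fin (w (M + 1)) × Fin (w 0)} {θ₀ : Params (M + 1) w}
    {S : Finset (Fin (w (M + 1)))} {T : ℕ} {C : ℝ}
    (hK : ∀ l, frobSq (θ₀ l) ≤ C) (hidx : ∀ t < T, (idx t).1 ∈ S) :
    HasTail S.card (((1 - η * lam) ^ 2) ^ T * C)
      (weight (sgd Astar lam η idx θ₀ T) M) := by
  rw [weight_of_lt _ (Nat.lt_succ_self M)]
  rw [← Matrix.transpose_transpose (sgd Astar lam η idx θ₀ T ⟨M, Nat.lt_succ_self M⟩)]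
  refine HasTail.transpose ((HasTail.of_columns _ (S := S) rfl).mono ?_)
  refine le_trans (le_of_eq ?_) (mul_le_mul_of_nonneg_left
    ((sum_columns_le_frobSq (θ₀ ⟨M, Nat.lt_succ_self M⟩).transpose Sᶜ).trans
      ((frobSq_transpose _).trans_le (hK _))) (by positivity))
  rw [Finset.mul_sum]
  refine Finset.sum_congr rfl fun a ha => ?_
  rw [Finset.mul_sum]
  refine Finset.sum_congr rfl fun c _ => ?_
  rw [Matrix.transpose_apply, Matrix.transpose_apply,
    sgd_last_apply Astar θ₀ hidx (Finset.mem_compl.1 ha), mul_pow, ← pow_mul, ← pow_mul,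
    mul_comm 2]

end Decay

/-- Some `r` of the `d` values of `g` account for a fraction of at least `r / d` of `I`: discard
the rarest value repeatedly. -/
lemma exists_frequent_values {ι : Type*} {d : ℕ} (I : Finset ι) (g : ι → Fin d) {r : ℕ}
    (hr : r ≤ d) :
    ∃ S : Finset (Fin d), S.card = r ∧ r * I.card ≤ d * (I.filter fun i => g i ∈ S).card := by
  induction hr using Nat.decreasingInduction with
  | self => exact ⟨Finset.univ, by simp, by simp⟩
  | of_succ k hk ih =>
    obtain ⟨S, hS, hle⟩ := ih
    have hne : S.Nonempty := Finset.card_pos.1 (by omega)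
    set N : Fin d → ℕ := fun a => (I.filter fun i => g i = a).card with hN
    obtain ⟨a, haS, ha⟩ := S.exists_min_image N hne
    refine ⟨S.erase a, by rw [Finset.card_erase_of_mem haS, hS]; rfl, ?_⟩
    have hcount : ∀ U : Finset (Fin d), (I.filter fun i => g i ∈ U).card = ∑ a ∈ U, N a := by
      intro U
      rw [Finset.card_eq_sum_card_fiberwise (f := g) (t := U) (fun i hi => by simp_all)]
      refine Finset.sum_congr rfl fun a ha => ?_
      rw [hN, Finset.filter_filter]
      congr 1
      ext i
      simp only [Finset.mem_filter]
      exact ⟨fun h => ⟨h.1, h.2.2⟩, fun h => ⟨h.1, h.2 ▸ ha, h.2⟩⟩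
    rw [hcount] at hle ⊢
    have h1 := Finset.sum_erase_add S N haS
    have h2 : (S.erase a).card • N a ≤ ∑ b ∈ S.erase a, N b :=
      Finset.card_nsmul_le_sum _ _ _ fun b hb => ha b (Finset.mem_of_mem_erase hb)
    rw [Finset.card_erase_of_mem haS, hS, Nat.add_sub_cancel, smul_eq_mul] at h2
    set X := ∑ b ∈ S.erase a, N b
    rw [← h1] at hle
    -- multiply by `k + 1`: `(k + 1) k |I| ≤ k d (X + N a) ≤ (k + 1) d X`
    have h3 : (k + 1) * (k * I.card) ≤ (k + 1) * (d * X) := by nlinarith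
    exact Nat.le_of_mul_le_mul_left h3 (Nat.succ_pos k)

/-! ### Sampling -/

/-- The event that all entries sampled in the window `[s, s + T)` lie in `G`. -/
def windowEvent {ι Ω : Type*} (idx : ℕ → Ω → ι) (G : Finset ι) (s T : ℕ) : Set Ω :=
  ⋂ t ∈ Finset.Ico s (s + T), {ω | idx t ω ∈ G}

lemma mem_windowEvent {ι Ω : Type*} {idx : ℕ → Ω → ι} {G : Finset ι} {s T : ℕ} {ω : Ω}
    (hω : ω ∈ windowEvent idx G s T) : ∀ t < T, idx (s + t) ω ∈ G := fun t ht => by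
  simp only [windowEvent, Set.mem_iInter, Finset.mem_Ico] at hω
  exact hω (s + t) ⟨by omega, by omega⟩

section Sampling

variable {ι Ω : Type*} [MeasurableSpace ι] [MeasurableSingletonClass ι] [DecidableEq ι]
  [MeasurableSpace Ω] {P : Measure Ω} {I : Finset ι} {idx : ℕ → Ω → ι}

lemma IsUniformSampling.measure_mem (h : IsUniformSampling P I idx) (G : Finset ι) (t : ℕ) :
    P {ω | idx t ω ∈ G} = (I ∩ G).card / I.card := by
  rw [← uniformOn_apply_finset, ← h.2.2 t, Measure.map_apply (h.1 t) G.measurableSet]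
  rfl

lemma IsUniformSampling.ae_mem [IsProbabilityMeasure P] (h : IsUniformSampling P I idx) (hI : I.Nonempty) :
    ∀ᵐ ω ∂P, ∀ t, idx t ω ∈ I := by
  refine ae_all_iff.2 fun t => ?_
  have h1 : P {ω | idx t ω ∈ I} = 1 := by
    rw [h.measure_mem, Finset.inter_self]
    exact ENNReal.div_self (by simpa using hI.ne_empty) (by simp)
  exact (prob_compl_eq_zero_iff ((h.1 t) I.measurableSet)).2 h1

lemma IsUniformSampling.measure_forall_mem (h : IsUniformSampling P I idx) (G : Finset ι)
    (s : Finset ℕ) :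
    P (⋂ t ∈ s, {ω | idx t ω ∈ G}) = ((I ∩ G).card / I.card) ^ s.card := by
  rw [h.2.1.meas_biInter (s := fun t => {ω | idx t ω ∈ G})
    fun t _ => ⟨G, G.measurableSet, rfl⟩]
  simp_rw [h.measure_mem]
  rw [Finset.prod_const]

lemma IsUniformSampling.measure_windowEvent (h : IsUniformSampling P I idx) (G : Finset ι)
    (s T : ℕ) : P (windowEvent idx G s T) = ((I ∩ G).card / I.card) ^ T := by
  rw [windowEvent, h.measure_forall_mem, Nat.card_Ico, Nat.add_sub_cancel_left]

/-- Disjoint windows are independent, so by the second Borel–Cantelli lemma almost surely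
some window contains samples from `G` only. -/
lemma IsUniformSampling.ae_exists_window [IsProbabilityMeasure P]
    (h : IsUniformSampling P I idx) {G : Finset ι} (hG : (I ∩ G).Nonempty) (s T : ℕ) :
    ∀ᵐ ω ∂P, ∃ k, ω ∈ windowEvent idx G (s + k * T) T := by
  set E : ℕ → Set Ω := fun k => windowEvent idx G (s + k * T) T with hE
  have hmeas : ∀ k, MeasurableSet (E k) := fun k =>
    Finset.measurableSet_biInter _ fun t _ => (h.1 t) G.measurableSet
  have hindep : iIndepSet E P := by
    rw [iIndepSet_iff_meas_biInter hmeas]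
    intro K
    have hdisj : (K : Set ℕ).PairwiseDisjoint
        fun k => Finset.Ico (s + k * T) (s + k * T + T) := by
      intro i _ j _ hij
      refine Finset.disjoint_left.2 fun t hi hj => ?_
      rw [Finset.mem_Ico] at hi hj
      rcases lt_or_gt_of_ne hij with hlt | hlt
      · have := Nat.mul_le_mul_right T (Nat.succ_le_of_lt hlt)
        rw [Nat.succ_mul] at this
        omega
      · have := Nat.mul_le_mul_right T (Nat.succ_le_of_lt hlt)
        rw [Nat.succ_mul] at this
        omega
    have hU : ⋂ k ∈ K, E k
        = ⋂ t ∈ K.biUnion fun k => Finset.Ico (s + k * T) (s + k * T + T),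
          {ω | idx t ω ∈ G} := by
      rw [Finset.set_biInter_biUnion]; rfl
    rw [hU, h.measure_forall_mem, Finset.card_biUnion hdisj]
    simp_rw [hE, h.measure_windowEvent, Nat.card_Ico, Nat.add_sub_cancel_left]
    rw [Finset.sum_const, Finset.prod_const, smul_eq_mul, mul_comm, pow_mul]
  have hsum : ∑' k, P (E k) = ⊤ := by
    simp_rw [hE, h.measure_windowEvent]
    refine ENNReal.tsum_const_eq_top_of_ne_zero (pow_ne_zero _ ?_)
    simp [ENNReal.div_eq_zero_iff, hG.ne_empty]
  have hlim := measure_limsup_eq_one hmeas hindep hsum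
  have hae : ∀ᵐ ω ∂P, ω ∈ Filter.limsup E Filter.atTop :=
    (prob_compl_eq_zero_iff (MeasurableSet.measurableSet_limsup hmeas)).2 hlim
  filter_upwards [hae] with ω hω
  rw [Filter.mem_limsup_iff_frequently_mem] at hω
  exact hω.exists

end Sampling

namespace SmallStep

variable {L : ℕ} {w : ℕ → ℕ} {C₁ C ε₁ lam η : ℝ}

lemma decay_pow_le (h : SmallStep L C₁ C ε₁ lam η) {α ε₂ m : ℝ} (hα : 0 < α) (hε₂ : 0 < ε₂)
    (hm : 0 < m) {T : ℕ} (hT : Real.log (4 * m * C / (α * ε₂)) / (2 * η * lam) ≤ T) :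
    ((1 - η * lam) ^ 2) ^ T * C * (4 * m) ≤ α * ε₂ := by
  have hx := h.decay_le
  have hx0 := h.decay_pos
  have hC := h.C_pos
  have e0 : 2 * η * lam = 2 * (η * lam) := by ring
  rw [e0, div_le_iff₀ (by positivity)] at hT
  have e1 : ((1 - η * lam) ^ 2) ^ T ≤ Real.exp (-(T * (2 * (η * lam)))) := by
    have e2 : -(T * (2 * (η * lam))) = ((2 * T : ℕ) : ℝ) * (-(η * lam)) := by push_cast; ring
    rw [← pow_mul, e2, Real.exp_nat_mul]
    have := Real.add_one_le_exp (-(η * lam))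
    gcongr
    · linarith
    · linarith
  have e3 : Real.exp (-(T * (2 * (η * lam)))) ≤ (4 * m * C / (α * ε₂))⁻¹ := by
    rw [Real.exp_neg]
    gcongr
    exact (Real.le_exp_log _).trans (Real.exp_le_exp.2 hT)
  have e4 := mul_le_mul_of_nonneg_right (e1.trans e3) (by positivity : 0 ≤ 4 * m * C)
  rw [inv_div, div_mul_cancel₀ _ (by positivity)] at e4
  linarith

/-- A set `G` of entries, with a share of at least `r / min (w 0) (w L)` of `I`, such that
sampling only from `G` for long enough drives bounded and balanced parameters into `B_r`: the
entries in the `r` most frequently observed columns, or rows. -/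
lemma exists_entries (h : SmallStep L C₁ C ε₁ lam η) (hL : 1 ≤ L)
    (Astar : Matrix (Fin (w L)) (Fin (w 0)) ℝ) (I : Finset (Fin (w L) × Fin (w 0)))
    {α ε₂ : ℝ} {r : ℕ} (hα : 0 < α) (hε₂ : 0 < ε₂)
    (hε₁ : 4 * ((maxWidth L w : ℝ) - r) * ((L : ℝ) - 1) * ε₁ ≤ α * ε₂)
    (hr : r ≤ min (w 0) (w L)) :
    ∃ G : Finset (Fin (w L) × Fin (w 0)), r * I.card ≤ min (w 0) (w L) * (I ∩ G).card ∧
      ∀ (idx : ℕ → Fin (w L) × Fin (w 0)) (θ₀ : Params L w) (T : ℕ),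
        (∀ t, Astar (idx t).1 (idx t).2 ^ 2 ≤ C₁) → θ₀ ∈ boundedBalanced L w C ε₁ →
        Real.log (4 * ((maxWidth L w : ℝ) - r) * C / (α * ε₂)) / (2 * η * lam) ≤ T →
        (∀ t < T, idx t ∈ G) → sgd Astar lam η idx θ₀ T ∈ setB L w r C α ε₁ ε₂ := by
  obtain ⟨M, rfl⟩ := Nat.exists_eq_add_of_le' hL
  have hC := h.C_pos
  have hrn : r ≤ maxWidth (M + 1) w :=
    (hr.trans (min_le_left _ _)).trans (width_le_maxWidth w (Nat.zero_le _))
  have hτ : ∀ T : ℕ,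
      Real.log (4 * ((maxWidth (M + 1) w : ℝ) - r) * C / (α * ε₂)) / (2 * η * lam) ≤ T →
      r < maxWidth (M + 1) w →
      ((1 - η * lam) ^ 2) ^ T * C * (4 * ((maxWidth (M + 1) w : ℝ) - r)) ≤ α * ε₂ :=
    fun T hT hlt => h.decay_pow_le hα hε₂ (sub_pos.2 (by exact_mod_cast hlt)) hT
  rcases le_total (w 0) (w (M + 1)) with hw | hw
  · rw [min_eq_left hw] at hr ⊢
    obtain ⟨S, hS, hle⟩ := exists_frequent_values I Prod.snd hr
    refine ⟨Finset.univ.filter fun p => p.2 ∈ S, ?_, fun idx θ₀ T hA hθ hT hG => ?_⟩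
    · rwa [Finset.inter_filter, Finset.inter_univ]
    · have htail := hasTail_first (lam := lam) (η := η) (Nat.succ_pos M) Astar (T := T) hθ.1
        fun t ht => (Finset.mem_filter.1 (hG t ht)).2
      rw [hS] at htail
      exact mem_setB_of_hasTail hα h.ε₁_pos.le hε₂.le hL hrn hε₁ (hτ T hT) (by positivity)
        (h.sgd_mem_boundedBalanced hA hθ T) (Nat.succ_pos M) htail
  · rw [min_eq_right hw] at hr ⊢
    obtain ⟨S, hS, hle⟩ := exists_frequent_values I Prod.fst hr
    refine ⟨Finset.univ.filter fun p => p.1 ∈ S, ?_, fun idx θ₀ T hA hθ hT hG => ?_⟩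
    · rwa [Finset.inter_filter, Finset.inter_univ]
    · have htail := hasTail_last (lam := lam) (η := η) Astar (T := T) hθ.1
        fun t ht => (Finset.mem_filter.1 (hG t ht)).2
      rw [hS] at htail
      exact mem_setB_of_hasTail hα h.ε₁_pos.le hε₂.le hL hrn hε₁ (hτ T hT) (by positivity)
        (h.sgd_mem_boundedBalanced hA hθ T) (Nat.lt_succ_self M) htail

end SmallStep

end DeepLinear

theorem theorem5 {L : ℕ} (hL : 3 ≤ L) (w : ℕ → ℕ)
    (Astar : Matrix (Fin (w L)) (Fin (w 0)) ℝ)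
    (I : Finset (Fin (w L) × Fin (w 0))) (hI : I.Nonempty)
    (C₁ : ℝ) (hC₁ : 0 < C₁) (hAstar : ∀ p ∈ I, Astar p.1 p.2 ^ 2 ≤ C₁)
    {Ω : Type*} [MeasurableSpace Ω] (P : Measure Ω) [IsProbabilityMeasure P]
    (idx : ℕ → Ω → Fin (w L) × Fin (w 0))
    (hidx : DeepLinear.IsUniformSampling P I idx)
    (r : ℕ) (lam C α ε₁ ε₂ η : ℝ)
    (hlam : 0 < lam) (hα : 0 < α) (hε₁ : 0 < ε₁) (hε₂ : 0 < ε₂) (hη : 0 < η) :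
    -- closedness of `B_r` under one SGD step
    (C₁ / (2 * lam) ≤ C →
      α ≤ (lam ^ 2 / (2 * (C₁ + C ^ L))) ^ (1 / ((L : ℝ) - 2)) →
      ε₂ < 1 / 2 →
      √ε₁ ≤ lam * α * ε₂ / (32 * (DeepLinear.maxWidth L w : ℝ) * L * (r + 1)
          * C ^ (((L : ℝ) - 1) / 2) * √(2 * (C₁ + C ^ L))) →
      η ≤ C₁ / (4 * (2 * (C₁ + C ^ L) * C ^ (L - 1) + lam ^ 2 * C)) →
      η ≤ 2 * lam * ε₁ / (4 * (C₁ + C ^ L) * C ^ (L - 1) + lam ^ 2 * ε₁) →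
      η ≤ lam * α * ε₂ / (32 * (DeepLinear.maxWidth L w : ℝ) * (r + 1)
          * (2 * (C₁ + C ^ L) * C ^ (L - 1) + lam ^ 2 * C)) →
      η ≤ 2 * (r + 1) / lam →
      ∀ θ ∈ DeepLinear.setB L w r C α ε₁ ε₂, ∀ p ∈ I,
        DeepLinear.sgdStep Astar lam η p θ ∈ DeepLinear.setB L w r C α ε₁ ε₂) ∧
    -- reaching `B_r` from an arbitrary starting point
    (C₁ / lam ≤ C →
      ε₁ ≤ C →
      4 * ((DeepLinear.maxWidth L w : ℝ) - r) * ((L : ℝ) - 1) * ε₁ ≤ α * ε₂ →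
      η ≤ lam * ε₁ / (4 * (C₁ + C ^ L) * C ^ (L - 1) + 2 * lam ^ 2 * C) →
      r ≤ min (w 0) (w L) →
      ∀ (θ₀ : DeepLinear.Params L w) (C₀ : ℝ), C₀ = DeepLinear.maxFrobSq θ₀ →
        η * (4 * (2 * (C₁ + C₀ ^ L) * C₀ ^ (L - 1) + lam ^ 2 * C₀)) ≤ C₁ →
        (∀ T₀ T₁ : ℕ,
          Real.log (2 * C₀ / ε₁) / (η * lam) ≤ T₀ →
          Real.log (4 * ((DeepLinear.maxWidth L w : ℝ) - r) * C / (α * ε₂)) / (2 * η * lam)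
            ≤ T₁ →
          ((r : ℝ) / (min (w 0) (w L) : ℕ)) ^ T₁ ≤
            P.real {ω | DeepLinear.sgd Astar lam η (fun t => idx t ω) θ₀ (T₀ + T₁) ∈
              DeepLinear.setB L w r C α ε₁ ε₂}) ∧
        (1 ≤ r → ∀ᵐ ω ∂P, ∃ T : ℕ,
          DeepLinear.sgd Astar lam η (fun t => idx t ω) θ₀ T ∈
            DeepLinear.setB L w r C α ε₁ ε₂)) := by
  refine ⟨fun hC hα' hε₂' hε₁' hη₁ hη₂ hη₃ _ θ hθ p hp =>
    DeepLinear.sgdStep_mem_setB hL hC₁ hlam hα hε₁ hε₂ hη (hAstar p hp) hC hα' hε₂' hε₁' hη₁ hη₂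
      hη₃ hθ, ?_⟩
  intro hC hε₁C hnr hη' hr θ₀ C₀ hC₀ hηC₀
  have hCpos : 0 < C := hε₁.trans_le hε₁C
  have hC' : C₁ ≤ lam * C := by rw [div_le_iff₀ hlam] at hC; linarith
  have hstep : DeepLinear.SmallStep L C₁ C ε₁ lam η := by
    refine ⟨hC₁, hlam, hε₁, hη, hC', hε₁C, ?_⟩
    rw [le_div_iff₀ (by positivity)] at hη'
    rw [DeepLinear.gradBound]
    linarith
  have hK₀ : ∀ l, DeepLinear.frobSq (θ₀ l) ≤ C₀ := fun l =>
    hC₀ ▸ DeepLinear.frobSq_le_maxFrobSq θ₀ l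
  have hC₀pos : 0 ≤ C₀ := (DeepLinear.frobSq_nonneg _).trans (hK₀ ⟨0, by omega⟩)
  have hburn : ∀ (T₀ : ℕ), Real.log (2 * C₀ / ε₁) / (η * lam) ≤ T₀ →
      ∀ ω, (∀ t, idx t ω ∈ I) → ∀ s, DeepLinear.sgd Astar lam η (fun t => idx t ω) θ₀ (T₀ + s)
        ∈ DeepLinear.boundedBalanced L w C ε₁ := fun T₀ hT₀ ω hω s => by
    rw [DeepLinear.sgd_add]
    exact hstep.sgd_mem_boundedBalanced (fun t => hAstar _ (hω _))
      (hstep.burn_in (fun t => hAstar _ (hω t)) hηC₀ hC₀pos hK₀ hT₀) s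
  obtain ⟨G, hGcard, hG⟩ := hstep.exists_entries (by omega) Astar I hα hε₂ hnr hr
  have hIpos : 0 < I.card := hI.card_pos
  obtain ⟨p₀, -⟩ := id hI
  have hd : 0 < min (w 0) (w L) := lt_min (Fin.pos p₀.2) (Fin.pos p₀.1)
  have hwindow : ∀ (T₀ T₁ : ℕ), Real.log (2 * C₀ / ε₁) / (η * lam) ≤ T₀ →
      Real.log (4 * ((DeepLinear.maxWidth L w : ℝ) - r) * C / (α * ε₂)) / (2 * η * lam) ≤ T₁ →
      ∀ s ω, (∀ t, idx t ω ∈ I) → ω ∈ DeepLinear.windowEvent idx G (T₀ + s) T₁ →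
        DeepLinear.sgd Astar lam η (fun t => idx t ω) θ₀ (T₀ + s + T₁)
          ∈ DeepLinear.setB L w r C α ε₁ ε₂ := fun T₀ T₁ hT₀ hT₁ s ω hω hmem => by
    rw [DeepLinear.sgd_add]
    exact hG _ _ T₁ (fun t => hAstar _ (hω _)) (hburn T₀ hT₀ ω hω s) hT₁
      (DeepLinear.mem_windowEvent hmem)
  refine ⟨fun T₀ T₁ hT₀ hT₁ => ?_, fun hr1 => ?_⟩
  · have hle : P (DeepLinear.windowEvent idx G T₀ T₁)
        ≤ P {ω | DeepLinear.sgd Astar lam η (fun t => idx t ω) θ₀ (T₀ + T₁) ∈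
          DeepLinear.setB L w r C α ε₁ ε₂} := by
      refine measure_mono_ae ?_
      filter_upwards [hidx.ae_mem hI] with ω hω hmem
      exact hwindow T₀ T₁ hT₀ hT₁ 0 ω hω hmem
    refine le_trans ?_ (ENNReal.toReal_mono (measure_ne_top _ _) hle)
    rw [hidx.measure_windowEvent, ENNReal.toReal_pow, ENNReal.toReal_div, ENNReal.toReal_natCast,
      ENNReal.toReal_natCast]
    refine pow_le_pow_left₀ (by positivity) ?_ _
    rw [div_le_div_iff₀ (by exact_mod_cast hd) (by exact_mod_cast hIpos)]
    rw [mul_comm (((I ∩ G).card : ℕ) : ℝ)]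
    exact_mod_cast hGcard
  · obtain ⟨T₀, hT₀⟩ := exists_nat_ge (Real.log (2 * C₀ / ε₁) / (η * lam))
    obtain ⟨T₁, hT₁⟩ := exists_nat_ge
      (Real.log (4 * ((DeepLinear.maxWidth L w : ℝ) - r) * C / (α * ε₂)) / (2 * η * lam))
    have hne : (I ∩ G).Nonempty := by
      rw [← Finset.card_pos]
      exact Nat.pos_of_mul_pos_left ((Nat.mul_pos hr1 hIpos).trans_le hGcard)
    filter_upwards [hidx.ae_mem hI, hidx.ae_exists_window hne T₀ T₁] with ω hω ⟨k, hk⟩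
    exact ⟨_, hwindow T₀ T₁ hT₀ hT₁ (k * T₁) ω hω hk⟩
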